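/- Let $\mathcal L=\mathbb Z v_1+\mathbb Z v_2$ be a lattice in $\mathbb R^2$ with fundamental domain $\Omega=\{sv_1+tv_2: 0\le s,t<1\}$ of area $1$, and let $\mathbf A_0(x,y)=\pi(-y,x)$. Let $\mathcal A$ be the set of all pairs $(u,\mathbf a)$ where $u\in H^1_{\mathrm{loc}}(\mathbb R^2;\mathbb C)$ satisfies $$u(z+v)=e^{i\pi(v_xy-v_yx)}\,u(z)\quad\text{for a.e. } z=(x,y)\in\mathbb R^2,\ \text{for } v=(v_x,v_y)\in\{v_1,v_2\},$$ and $\mathbf a\in H^1_{\mathrm{loc}}(\mathbb R^2;\mathbb R^2)$ is $\mathcal L$-periodic with $\operatorname{div}\mathbf a=0$ and $\int_\Omega\mathbf a=0$. For $k>0$, $H_{ext}>0$ and $H_{int}>0$ put $\mu=\frac{H_{int}}{2\pi k}$ and $$E_{k,H_{int}}(u,\mathbf a)=\int_\Omega \frac{\mu}{2}\,\|i\nabla u+(\mathbf A_0+\mathbf a)u\|^2+\frac14(1-|u|^2)^2+\frac{\mu^2k^2}{2}\,|\operatorname{curl}\mathbf a|^2,$$ and let the minimal energy be $$\mathcal E_{k,H_{ext}}=\inf_{H_{int}>0,\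 (u,\mathbf a)\in\mathcal A}\Big(E_{k,H_{int}}(u,\mathbf a)+\tfrac12(H_{int}-H_{ext})^2\Big).$$ Let $E_{\mathcal N}=\frac14$ (normal state) and $E_{\mathcal P}=\frac{H_{ext}^2}{2}$ (pure state), and let $\mathcal N$ (respectively $\mathcal P$) be the set of all $(k,H_{ext})\in(0,\infty)^2$ with $\mathcal E_{k,H_{ext}}=E_{\mathcal N}$ (respectively $\mathcal E_{k,H_{ext}}=E_{\mathcal P}$). Theorem (Type I superconductors). Let $k>0$, $H_{ext}>0$ and $k\le\frac1{\sqrt2}$. (i) If $H_{ext}\le\frac1{\sqrt2}$, then $\mathcal E_{k,H_{ext}}=E_{\mathcal P}$ and $(k,H_{ext})\in\mathcal P$. (ii) If $H_{ext}\ge\frac1{\sqrt2}$, then $\mathcal E_{k,H_{ext}}=E_{\mathcal N}$ and $(k,H_{ext})\in\mathcal N$. -/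

import Mathlib

open MeasureTheory
open scoped ENNReal ContDiff

/-! The plane is `ℝ × ℝ` with coordinates `(x, y)` and Lebesgue measure `volume`; only its topology,
linear structure and measure are used, never a norm. Lattices are given by an `ℝ`-basis `b`
of the plane, the lattice being `Submodule.span ℤ (Set.range b)` and the fundamental domain
the half-open parallelogram `ZSpan.fundamentalDomain b`. -/

namespace GinzburgLandau

section Sobolev

variable {F : Type*} [NormedAddCommGroup F] [NormedSpace ℝ F]

/-- `f` is of class `L²_loc` on the plane. -/
def L2Loc (f : ℝ × ℝ → F) : Prop :=
  ∀ K : Set (ℝ × ℝ), IsCompact K → MemLp f 2 (volume.restrict K)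

/-- `g` is the weak (distributional) derivative of `f` in the direction `e`. -/
structure IsWeakDeriv (e : ℝ × ℝ) (f g : ℝ × ℝ → F) : Prop where
  locallyIntegrable : LocallyIntegrable f volume
  locallyIntegrable_deriv : LocallyIntegrable g volume
  integral_eq : ∀ φ : ℝ × ℝ → ℝ, ContDiff ℝ ∞ φ → HasCompactSupport φ →
    ∫ z, (fderiv ℝ φ z e) • f z = - ∫ z, φ z • g z

open Classical in
/-- The weak derivative of `f` in the direction `e`. It is determined up to a null set,
and a representative is chosen; it is set to `0` if there is none. -/
noncomputable def weakDeriv (e : ℝ × ℝ) (f : ℝ × ℝ → F) : ℝ × ℝ → F :=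
  if h : ∃ g, IsWeakDeriv e f g then h.choose else 0

/-- The weak partial derivative `∂f/∂x`. -/
noncomputable def dx (f : ℝ × ℝ → F) : ℝ × ℝ → F := weakDeriv (1, 0) f

/-- The weak partial derivative `∂f/∂y`. -/
noncomputable def dy (f : ℝ × ℝ → F) : ℝ × ℝ → F := weakDeriv (0, 1) f

/-- `f` is of class `H¹_loc` on the plane: `f` is in `L²_loc`, and so are
its two weak partial derivatives. -/
structure H1Loc (f : ℝ × ℝ → F) : Prop where
  l2Loc : L2Loc f
  exists_dx : ∃ g, L2Loc g ∧ IsWeakDeriv (1, 0) f g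
  exists_dy : ∃ g, L2Loc g ∧ IsWeakDeriv (0, 1) f g

end Sobolev

/-- The divergence `∂a_x/∂x + ∂a_y/∂y` of a vector field, in the weak sense. -/
noncomputable def div (a : ℝ × ℝ → ℝ × ℝ) (z : ℝ × ℝ) : ℝ :=
  dx (fun w => (a w).1) z + dy (fun w => (a w).2) z

/-- The curl `∂a_y/∂x - ∂a_x/∂y` of a vector field, in the weak sense. -/
noncomputable def curl (a : ℝ × ℝ → ℝ × ℝ) (z : ℝ × ℝ) : ℝ :=
  dx (fun w => (a w).2) z - dy (fun w => (a w).1) z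

/-- `u` is an `H¹_loc` section of the line bundle `E₁` over the torus, i.e.
`u (z + v) = exp (i π (v_x y - v_y x)) u z` for the two generators `v` of the lattice.
For `v = m b₀ + n b₁` the multiplier is then `(-1) ^ (m n) exp (i π (v_x y - v_y x))`, since the
generators span a cell of area `1`. -/
structure IsSection (b : Module.Basis (Fin 2) ℝ (ℝ × ℝ)) (u : ℝ × ℝ → ℂ) : Prop where
  h1Loc : H1Loc u
  quasiperiodic : ∀ j : Fin 2, ∀ᵐ z : ℝ × ℝ,
    u (z + b j) =
      Complex.exp (Complex.I * ((Real.pi * ((b j).1 * z.2 - (b j).2 * z.1) : ℝ) : ℂ)) * u z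

/-- `a` is an admissible potential: an `H¹_loc` vector field that is periodic with respect to the
lattice, divergence free, and of mean zero over the fundamental domain. -/
structure IsPotential (b : Module.Basis (Fin 2) ℝ (ℝ × ℝ)) (a : ℝ × ℝ → ℝ × ℝ) : Prop where
  h1Loc_fst : H1Loc (fun z => (a z).1)
  h1Loc_snd : H1Loc (fun z => (a z).2)
  div_eq_zero : ∀ᵐ z : ℝ × ℝ, div a z = 0
  periodic : ∀ v ∈ Submodule.span ℤ (Set.range b), ∀ᵐ z : ℝ × ℝ, a (z + v) = a z
  integral_eq_zero : ∫ z in ZSpan.fundamentalDomain b, a z = 0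

/-- The space of admissible pairs `(u, a)`. -/
def admissible (b : Module.Basis (Fin 2) ℝ (ℝ × ℝ)) :
    Set ((ℝ × ℝ → ℂ) × (ℝ × ℝ → ℝ × ℝ)) :=
  {p | IsSection b p.1 ∧ IsPotential b p.2}

/-- The potential `A₀ = π (-y, x)`. -/
noncomputable def A₀ (z : ℝ × ℝ) : ℝ × ℝ := (-(Real.pi * z.2), Real.pi * z.1)

/-- `‖i ∇u + (A₀ + a) u‖²` at the point `z`. -/
noncomputable def covGradSq (u : ℝ × ℝ → ℂ) (a : ℝ × ℝ → ℝ × ℝ) (z : ℝ × ℝ) : ℝ :=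
  ‖Complex.I * dx u z + (((A₀ z).1 + (a z).1 : ℝ) : ℂ) * u z‖ ^ 2 +
    ‖Complex.I * dy u z + (((A₀ z).2 + (a z).2 : ℝ) : ℂ) * u z‖ ^ 2

/-- The parameter `μ = H_int / (2 π k)`. -/
noncomputable def mu (k Hint : ℝ) : ℝ := Hint / (2 * Real.pi * k)

/-- The (non-negative) density of the internal energy. -/
noncomputable def density (k Hint : ℝ) (u : ℝ × ℝ → ℂ) (a : ℝ × ℝ → ℝ × ℝ) (z : ℝ × ℝ) : ℝ :=
  mu k Hint / 2 * covGradSq u a z + 1 / 4 * (1 - ‖u z‖ ^ 2) ^ 2 +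
    mu k Hint ^ 2 * k ^ 2 / 2 * |curl a z| ^ 2

/-- The internal energy `E_{k, H_int}(u, a)`, for `k > 0` and `H_int > 0`: the integral of the
non-negative density over the fundamental domain, as an element of `[0, ∞]`. -/
noncomputable def internalEnergy (b : Module.Basis (Fin 2) ℝ (ℝ × ℝ)) (k Hint : ℝ)
    (u : ℝ × ℝ → ℂ) (a : ℝ × ℝ → ℝ × ℝ) : ℝ≥0∞ :=
  ∫⁻ z in ZSpan.fundamentalDomain b, ENNReal.ofReal (density k Hint u a z)

/-- The energy `E_{k, H_ext}(H_int, u, a)` of the superconductor. -/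
noncomputable def totalEnergy (b : Module.Basis (Fin 2) ℝ (ℝ × ℝ)) (k Hext Hint : ℝ)
    (u : ℝ × ℝ → ℂ) (a : ℝ × ℝ → ℝ × ℝ) : ℝ≥0∞ :=
  internalEnergy b k Hint u a + ENNReal.ofReal (1 / 2 * (Hint - Hext) ^ 2)

/-- The minimal energy: the infimum of the energy over all internal
fields `H_int > 0` and all admissible pairs. -/
noncomputable def minEnergy (b : Module.Basis (Fin 2) ℝ (ℝ × ℝ)) (k Hext : ℝ) : ℝ≥0∞ :=
  ⨅ (Hint : ℝ) (_ : 0 < Hint) (p ∈ admissible b), totalEnergy b k Hext Hint p.1 p.2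

/-- The energy `1 / 4` of the normal state. -/
noncomputable def normalEnergy : ℝ≥0∞ := ENNReal.ofReal (1 / 4)

/-- The energy `H_ext² / 2` of the pure state. -/
noncomputable def pureEnergy (Hext : ℝ) : ℝ≥0∞ := ENNReal.ofReal (Hext ^ 2 / 2)

/-- The set of parameters `(k, H_ext)` for which the minimal energy is that of the normal state. -/
def normalSet (b : Module.Basis (Fin 2) ℝ (ℝ × ℝ)) : Set (ℝ × ℝ) :=
  {p | 0 < p.1 ∧ 0 < p.2 ∧ minEnergy b p.1 p.2 = normalEnergy}

/-- The set of parameters `(k, H_ext)` for which the minimal energy is that of the pure state. -/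
def pureSet (b : Module.Basis (Fin 2) ℝ (ℝ × ℝ)) : Set (ℝ × ℝ) :=
  {p | 0 < p.1 ∧ 0 < p.2 ∧ minEnergy b p.1 p.2 = pureEnergy p.2}

end GinzburgLandau

/-! The lower bounds rest on the Bogomolny trick at the self-dual value of the coupling, `s = 1 /
√2`. Write `D = i∇ + A₀ + a`. The expression `2 Im (D_x u · conj (D_y u)) + (2π + curl a) |u|²` is
the weak curl of the supercurrent `Re (conj u · D u)`. The current is periodic because `D u` has the
same multipliers as `u`, so this curl has mean zero, and `2 |D_x u| |D_y u| ≤ |D u|²` gives `∫ (2π +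
curl a) |u|² ≤ ∫ |D u|²` (`setIntegral_crossTerm`, `setIntegral_curl_mul_le_setIntegral_covGradSq`).

Since `k ≤ s` and `s² = 1/2`, the coefficient `μ / 2` of the kinetic term is at least `s μ k`. With
`m = μ k = H_int / 2π`, `h = H_int + m curl a` and `w = |u|²`, the internal energy is therefore at
least the mean of `s h w + (1 - w)² / 4 + (h - H_int)² / 2`. As `curl a` has mean zero, `h` has mean
`H_int`, and any multiple of `curl a` may be discarded. Completing the square in two ways yields the
two bounds `pureEnergy_le_totalEnergy` and `normalEnergy_le_totalEnergy`, both through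
`le_setIntegral_density`.

The upper bounds come from trial states. The normal energy is the energy of `u = 0`, `a = 0`, `H_int
= H_ext`. The pure energy is approached as `H_int → 0`, which switches off the kinetic term, with
smooth sections whose modulus tends to `1` almost everywhere.

At `H¹_loc` regularity the curl identity needs work: mollification gives a product rule and a
Jacobian identity, the embedding into `L⁴_loc` makes the products integrable, and testing against
`1_Ω ⋆ ρ` turns a weak identity on the plane into one about means over the cell `Ω`. -/

namespace GinzburgLandau

/-! ### Mollification and its convergence in `Lᵖ_loc`. -/

open Filter Topology Convolution

/-- `f` is of class `Lᵖ_loc` on the plane. -/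
def LpLoc (p : ℝ≥0∞) (f : ℝ × ℝ → ℝ) : Prop :=
  ∀ K : Set (ℝ × ℝ), IsCompact K → MemLp f p (volume.restrict K)

theorem LpLoc.locallyIntegrable {p : ℝ≥0∞} (hp : 1 ≤ p) {f : ℝ × ℝ → ℝ} (hf : LpLoc p f) :
    LocallyIntegrable f volume :=
  (locallyIntegrable_iff).2 fun K hK => by
    have : IsFiniteMeasure (volume.restrict K) := ⟨by simpa using hK.measure_lt_top⟩
    exact (hf K hK).integrable hp

/-- A sequence of bump functions shrinking to the origin. -/
noncomputable def shrinkingBump (n : ℕ) : ContDiffBump (0 : ℝ × ℝ) where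
  rIn := 1 / (n + 2)
  rOut := 1 / (n + 1)
  rIn_pos := by positivity
  rIn_lt_rOut := by gcongr; norm_num

/-- The mollifying kernel, a normalized bump function. -/
noncomputable def kernel (n : ℕ) : ℝ × ℝ → ℝ := (shrinkingBump n).normed volume

theorem kernel_nonneg (n : ℕ) (x : ℝ × ℝ) : 0 ≤ kernel n x :=
  (shrinkingBump n).nonneg_normed x

theorem contDiff_kernel (n : ℕ) : ContDiff ℝ ∞ (kernel n) := (shrinkingBump n).contDiff_normed

theorem continuous_kernel (n : ℕ) : Continuous (kernel n) := (contDiff_kernel n).continuous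

theorem hasCompactSupport_kernel (n : ℕ) : HasCompactSupport (kernel n) :=
  (shrinkingBump n).hasCompactSupport_normed

theorem integral_kernel (n : ℕ) : ∫ x, kernel n x = 1 := (shrinkingBump n).integral_normed

theorem kernel_eq_zero {n : ℕ} {x : ℝ × ℝ} (hx : 1 / ((n : ℝ) + 1) ≤ ‖x‖) : kernel n x = 0 := by
  have h : x ∉ Function.support (kernel n) := by
    rw [kernel, (shrinkingBump n).support_normed_eq]
    simpa [shrinkingBump] using hx
  simpa using h

theorem integrable_kernel (n : ℕ) : Integrable (kernel n) :=
  (continuous_kernel n).integrable_of_hasCompactSupport (hasCompactSupport_kernel n)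

/-- The mollification of `f` at scale `1 / (n + 1)`. -/
noncomputable def mollify (n : ℕ) (f : ℝ × ℝ → ℝ) : ℝ × ℝ → ℝ :=
  f ⋆[ContinuousLinearMap.mul ℝ ℝ, volume] kernel n

theorem mollify_apply (n : ℕ) (f : ℝ × ℝ → ℝ) (x : ℝ × ℝ) :
    mollify n f x = ∫ t, f (x - t) * kernel n t := by
  rw [mollify, convolution_mul_swap]

theorem contDiff_mollify (n : ℕ) {f : ℝ × ℝ → ℝ} (hf : LocallyIntegrable f volume) :
    ContDiff ℝ ∞ (mollify n f) :=
  (hasCompactSupport_kernel n).contDiff_convolution_right _ hf (contDiff_kernel n)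

theorem integrable_mollify_integrand (n : ℕ) {f : ℝ × ℝ → ℝ} (hf : LocallyIntegrable f volume)
    (x : ℝ × ℝ) : Integrable fun t => f (x - t) * kernel n t := by
  have := (hasCompactSupport_kernel n).convolutionExists_right
    (ContinuousLinearMap.mul ℝ ℝ) hf (continuous_kernel n) x
  simpa using this.integrable_swap

/-- The derivative falls on the kernel, and `t ↦ kernel n (x - t)` is itself a test function for the
weak derivative. The sign from the reflection cancels the sign from integration by parts. -/
theorem fderiv_mollify (n : ℕ) {e : ℝ × ℝ} {f g : ℝ × ℝ → ℝ} (h : IsWeakDeriv e f g)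
    (x : ℝ × ℝ) : fderiv ℝ (mollify n f) x e = mollify n g x := by
  have h1 := (hasCompactSupport_kernel n).hasFDerivAt_convolution_right
    (ContinuousLinearMap.mul ℝ ℝ) h.locallyIntegrable
    ((contDiff_kernel n).of_le (by exact_mod_cast le_top)) x
  have hd : ∀ t, HasFDerivAt (fun t => kernel n (x - t)) (-(fderiv ℝ (kernel n) (x - t))) t := by
    intro t
    have := (((contDiff_kernel n).differentiable (by simp)) (x - t)).hasFDerivAt.comp t
      ((hasFDerivAt_const x t).sub (hasFDerivAt_id t))
    convert! this using 1
    ext <;> simp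
  have hsub : ContDiff ℝ ∞ fun t : ℝ × ℝ => kernel n (x - t) :=
    (contDiff_kernel n).comp (contDiff_const.sub contDiff_id)
  have hsupp : HasCompactSupport fun t : ℝ × ℝ => kernel n (x - t) :=
    (hasCompactSupport_kernel n).comp_homeomorph (Homeomorph.subLeft x)
  have h2 := h.integral_eq _ hsub hsupp
  rw [mollify, h1.fderiv, convolution_precompR_apply _ h.locallyIntegrable
    ((hasCompactSupport_kernel n).fderiv ℝ)
    ((contDiff_kernel n).continuous_fderiv (by simp)), mollify, convolution_mul, convolution_mul]
  simp only [(hd _).fderiv, smul_eq_mul, neg_apply, neg_mul, integral_neg, neg_inj] at h2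
  simp_rw [mul_comm (f _), mul_comm (g _)]
  exact h2

/-- Translations preserve the measure and depend continuously on `t` as maps, and composition with
such maps is continuous in `Lᵖ` for finite `p`. -/
theorem tendsto_eLpNorm_translate_sub {p : ℝ≥0∞} (hp1 : 1 ≤ p) (hp : p ≠ ⊤) {f : ℝ × ℝ → ℝ}
    (hf : MemLp f p volume) :
    Tendsto (fun t : ℝ × ℝ => eLpNorm (fun x => f (x - t) - f x) p volume) (𝓝 0) (𝓝 0) := by
  have : Fact (1 ≤ p) := ⟨hp1⟩
  let g : ℝ × ℝ → C(ℝ × ℝ, ℝ × ℝ) := fun t => ⟨fun x => x - t, by fun_prop⟩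
  have hg : Continuous g := by
    let G : C((ℝ × ℝ) × (ℝ × ℝ), ℝ × ℝ) := ⟨fun a => a.2 - a.1, by fun_prop⟩
    exact G.curry.continuous
  have hgm : ∀ t, MeasurePreserving (g t) (volume : Measure (ℝ × ℝ)) volume := fun t =>
    measurePreserving_sub_right volume t
  have hc : Continuous fun t => Lp.compMeasurePreserving (g t) (hgm t) (hf.toLp f) :=
    Continuous.compMeasurePreservingLp continuous_const hg hgm hp
  have h0 := hc.tendsto 0
  rw [tendsto_iff_edist_tendsto_0] at h0
  refine h0.congr fun t => ?_
  rw [Lp.edist_def]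
  have e1 : ∀ t, (Lp.compMeasurePreserving (g t) (hgm t) (hf.toLp f) : ℝ × ℝ → ℝ)
      =ᵐ[volume] fun x => f (x - t) := fun t =>
    (Lp.coeFn_compMeasurePreserving _ _).trans
      ((hgm t).quasiMeasurePreserving.ae_eq_comp hf.coeFn_toLp)
  refine eLpNorm_congr_ae (((e1 t).sub (e1 0)).trans (Eventually.of_forall fun x => ?_))
  simp

/-- Jensen's inequality for the probability measure with density `kernel n`, in the form of the
monotonicity of `Lᵖ` norms on a probability space. -/
theorem enorm_integral_mul_kernel_rpow_le {p : ℝ} (hp : 1 ≤ p) (n : ℕ) {h : ℝ × ℝ → ℝ}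
    (hh : AEStronglyMeasurable h volume) :
    ‖∫ t, h t * kernel n t‖ₑ ^ p ≤ ∫⁻ t, ‖h t‖ₑ ^ p * ENNReal.ofReal (kernel n t) := by
  have hp0 : 0 < p := by linarith
  have hkm : Measurable fun t => ENNReal.ofReal (kernel n t) :=
    (continuous_kernel n).measurable.ennreal_ofReal
  let ν : Measure (ℝ × ℝ) := volume.withDensity fun t => ENNReal.ofReal (kernel n t)
  have : IsProbabilityMeasure ν := by
    constructor
    rw [withDensity_apply _ MeasurableSet.univ, Measure.restrict_univ,
      ← ofReal_integral_eq_lintegral_ofReal (integrable_kernel n)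
        (Eventually.of_forall (kernel_nonneg n)), integral_kernel]
    simp
  have hhν : AEStronglyMeasurable h ν := hh.mono_ac (withDensity_absolutelyContinuous _ _)
  have e1 : ‖∫ t, h t * kernel n t‖ₑ ≤ ∫⁻ t, ‖h t‖ₑ ∂ν := by
    refine (enorm_integral_le_lintegral_enorm _).trans_eq ?_
    rw [lintegral_withDensity_eq_lintegral_mul_non_measurable _ hkm (by simp)]
    refine lintegral_congr fun t => ?_
    rw [enorm_mul, Pi.mul_apply, mul_comm, Real.enorm_of_nonneg (kernel_nonneg n t)]
  have e2 : ∫⁻ t, ‖h t‖ₑ ∂ν ≤ (∫⁻ t, ‖h t‖ₑ ^ p ∂ν) ^ (1 / p) := by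
    have := eLpNorm'_le_eLpNorm'_of_exponent_le (μ := ν) one_pos hp hhν
    simpa [eLpNorm'] using this
  calc ‖∫ t, h t * kernel n t‖ₑ ^ p ≤ ((∫⁻ t, ‖h t‖ₑ ^ p ∂ν) ^ (1 / p)) ^ p :=
        ENNReal.rpow_le_rpow (e1.trans e2) hp0.le
    _ = ∫⁻ t, ‖h t‖ₑ ^ p ∂ν := by
        rw [← ENNReal.rpow_mul, one_div, inv_mul_cancel₀ hp0.ne', ENNReal.rpow_one]
    _ = _ := by
        rw [lintegral_withDensity_eq_lintegral_mul_non_measurable _ hkm (by simp)]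
        refine lintegral_congr fun t => ?_
        rw [Pi.mul_apply, mul_comm]

/-- The error `mollify n f - f` is an average of the differences `f (· - t) - f` over small `t`.
Jensen and Tonelli bound its norm by the largest norm of such a difference. -/
theorem tendsto_eLpNorm_mollify_sub_of_memLp {p : ℝ≥0∞} (hp1 : 1 ≤ p) (hp : p ≠ ⊤)
    {f : ℝ × ℝ → ℝ} (hf : MemLp f p volume) :
    Tendsto (fun n => eLpNorm (mollify n f - f) p volume) atTop (𝓝 0) := by
  have hloc : LocallyIntegrable f volume := hf.locallyIntegrable hp1
  have hp0 : p ≠ 0 := (one_pos.trans_le hp1).ne'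
  have hr : 1 ≤ p.toReal := by
    rw [← ENNReal.toReal_one]; exact ENNReal.toReal_mono hp hp1
  have hr0 : 0 < p.toReal := by linarith
  rw [ENNReal.tendsto_atTop_zero]
  intro ε hε
  have h1 := (tendsto_eLpNorm_translate_sub hp1 hp hf).eventually (gt_mem_nhds hε)
  obtain ⟨δ, hδ, hball⟩ := Metric.eventually_nhds_iff.1 h1
  obtain ⟨N, hN⟩ := exists_nat_one_div_lt hδ
  refine ⟨N, fun n hn => ?_⟩
  have hmeas : ∀ x, AEStronglyMeasurable (fun t => f (x - t) - f x) volume := fun x =>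
    (hf.1.comp_quasiMeasurePreserving
      (quasiMeasurePreserving_sub_left volume x)).sub aestronglyMeasurable_const
  have hpt : ∀ x, (mollify n f - f) x = ∫ t, (f (x - t) - f x) * kernel n t := by
    intro x
    simp_rw [sub_mul]
    rw [integral_sub (integrable_mollify_integrand n hloc x) ((integrable_kernel n).const_mul _),
      integral_const_mul, integral_kernel, Pi.sub_apply, mollify_apply, mul_one]
  have hsm2 : AEMeasurable (fun a : (ℝ × ℝ) × (ℝ × ℝ) =>
      ‖f (a.1 - a.2) - f a.1‖ₑ ^ p.toReal * ENNReal.ofReal (kernel n a.2))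
      (volume.prod volume) := by
    have m1 : AEStronglyMeasurable (fun a : (ℝ × ℝ) × (ℝ × ℝ) => f (a.1 - a.2))
        (volume.prod volume) :=
      hf.1.comp_quasiMeasurePreserving
        (quasiMeasurePreserving_sub_of_right_invariant volume volume)
    have m2 : AEStronglyMeasurable (fun a : (ℝ × ℝ) × (ℝ × ℝ) => f a.1)
        (volume.prod volume) := hf.1.comp_fst
    refine ((m1.sub m2).enorm.pow_const _).mul ?_
    exact ((continuous_kernel n).measurable.comp measurable_snd).ennreal_ofReal.aemeasurable
  have key : ∫⁻ x, ‖(mollify n f - f) x‖ₑ ^ p.toReal ≤ ε ^ p.toReal := by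
    calc ∫⁻ x, ‖(mollify n f - f) x‖ₑ ^ p.toReal
        ≤ ∫⁻ x, ∫⁻ t, ‖f (x - t) - f x‖ₑ ^ p.toReal * ENNReal.ofReal (kernel n t) := by
          refine lintegral_mono fun x => ?_
          simp only [hpt x]
          exact enorm_integral_mul_kernel_rpow_le hr n (hmeas x)
      _ = ∫⁻ t, ∫⁻ x, ‖f (x - t) - f x‖ₑ ^ p.toReal * ENNReal.ofReal (kernel n t) :=
          lintegral_lintegral_swap hsm2
      _ ≤ ∫⁻ t, ε ^ p.toReal * ENNReal.ofReal (kernel n t) := by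
          refine lintegral_mono fun t => ?_
          rw [lintegral_mul_const' _ _ ENNReal.ofReal_ne_top]
          by_cases ht : 1 / ((n : ℝ) + 1) ≤ ‖t‖
          · simp [kernel_eq_zero ht]
          gcongr
          have hlt : dist t 0 < δ := by
            rw [dist_zero_right]
            refine (not_le.1 ht).trans (lt_of_le_of_lt ?_ hN)
            gcongr
          have := (hball hlt).le
          rw [eLpNorm_eq_lintegral_rpow_enorm_toReal hp0 hp, one_div,
            ENNReal.rpow_inv_le_iff hr0] at this
          exact this
      _ = ε ^ p.toReal := by
          rw [lintegral_const_mul _ (continuous_kernel n).measurable.ennreal_ofReal,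
            ← ofReal_integral_eq_lintegral_ofReal (integrable_kernel n)
              (Eventually.of_forall (kernel_nonneg n)), integral_kernel]
          simp
  rw [eLpNorm_eq_lintegral_rpow_enorm_toReal hp0 hp, one_div, ENNReal.rpow_inv_le_iff hr0]
  exact key

/-- The kernels live in the unit ball, so on `K` the mollification only sees `f` on the closed
`1`-neighbourhood of `K`. Cutting `f` off there reduces to the global statement. -/
theorem tendsto_eLpNorm_mollify_sub {p : ℝ≥0∞} (hp1 : 1 ≤ p) (hp : p ≠ ⊤)
    {f : ℝ × ℝ → ℝ} (hf : LpLoc p f) {K : Set (ℝ × ℝ)} (hK : IsCompact K) :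
    Tendsto (fun n => eLpNorm (mollify n f - f) p (volume.restrict K)) atTop (𝓝 0) := by
  have hK' : IsCompact (Metric.cthickening 1 K) := hK.cthickening
  set f' := (Metric.cthickening 1 K).indicator f with hf'
  have hmem : MemLp f' p volume :=
    (memLp_indicator_iff_restrict hK'.measurableSet).2 (hf _ hK')
  refine tendsto_of_tendsto_of_tendsto_of_le_of_le tendsto_const_nhds
    (tendsto_eLpNorm_mollify_sub_of_memLp hp1 hp hmem) (fun _ => zero_le) fun n => ?_
  refine le_trans (b := eLpNorm (mollify n f' - f') p (volume.restrict K)) (le_of_eq ?_) (eLpNorm_mono_measure _ (Measure.restrict_le_self (s := K)))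
  refine eLpNorm_congr_ae ?_
  filter_upwards [ae_restrict_mem hK.measurableSet] with x hx
  have e0 : f' x = f x := Set.indicator_of_mem (Metric.self_subset_cthickening K hx) f
  simp only [Pi.sub_apply, e0, mollify_apply]
  congr 1
  refine integral_congr_ae (Eventually.of_forall fun t => ?_)
  by_cases ht : 1 / ((n : ℝ) + 1) ≤ ‖t‖
  · simp [kernel_eq_zero ht]
  have : x - t ∈ Metric.cthickening 1 K := by
    refine Metric.mem_cthickening_of_dist_le _ x _ _ hx ?_
    rw [dist_eq_norm]
    simp only [sub_sub_cancel_left, norm_neg]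
    refine (not_le.1 ht).le.trans ?_
    rw [div_le_one (by positivity)]
    linarith [n.cast_nonneg (α := ℝ)]
  simp [hf', this]

end GinzburgLandau

/-! ### Product rule and Jacobian identity for weak derivatives. -/

namespace GinzburgLandau

open Filter Topology Convolution

theorem LpLoc.of_continuous {p : ℝ≥0∞} {f : ℝ × ℝ → ℝ} (hf : Continuous f) : LpLoc p f := by
  intro K hK
  have : IsFiniteMeasure (volume.restrict K) := ⟨by simpa using hK.measure_lt_top⟩
  obtain ⟨C, hC⟩ := hK.exists_bound_of_continuousOn hf.continuousOn
  exact MemLp.of_bound hf.aestronglyMeasurable C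
    ((ae_restrict_iff' hK.measurableSet).2 (Eventually.of_forall hC))

theorem LpLoc.add {p : ℝ≥0∞} {f g : ℝ × ℝ → ℝ} (hf : LpLoc p f) (hg : LpLoc p g) :
    LpLoc p fun z => f z + g z := fun K hK => (hf K hK).add (hg K hK)

theorem LpLoc.sub {p : ℝ≥0∞} {f g : ℝ × ℝ → ℝ} (hf : LpLoc p f) (hg : LpLoc p g) :
    LpLoc p fun z => f z - g z := fun K hK => (hf K hK).sub (hg K hK)

theorem LpLoc.const_mul {p : ℝ≥0∞} {f : ℝ × ℝ → ℝ} (c : ℝ) (hf : LpLoc p f) :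
    LpLoc p fun z => c * f z := fun K hK => (hf K hK).const_mul c

theorem LpLoc.mul {p q r : ℝ≥0∞} [ENNReal.HolderTriple p q r] {f g : ℝ × ℝ → ℝ}
    (hf : LpLoc p f) (hg : LpLoc q g) : LpLoc r fun z => f z * g z :=
  fun K hK => (hg K hK).mul' (hf K hK)

theorem LpLoc.mono_exponent {p q : ℝ≥0∞} (hpq : p ≤ q) {f : ℝ × ℝ → ℝ} (hf : LpLoc q f) :
    LpLoc p f := fun K hK => by
  have : IsFiniteMeasure (volume.restrict K) := ⟨by simpa using hK.measure_lt_top⟩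
  exact (hf K hK).mono_exponent hpq

theorem integrable_mul_of_hasCompactSupport {φ f : ℝ × ℝ → ℝ} (hf : LocallyIntegrable f volume)
    (hφ : Continuous φ) (hφs : HasCompactSupport φ) : Integrable fun z => φ z * f z :=
  hf.integrable_smul_left_of_hasCompactSupport hφ hφs

/-- Hölder on the support of `φ`. This is the one passage to the limit used to transfer identities
from mollified to weakly differentiable functions. -/
theorem tendsto_integral_mul_mollify {p q : ℝ≥0∞} [ENNReal.HolderTriple q p 1] (hp1 : 1 ≤ p)
    (hp : p ≠ ⊤) {w h φ : ℝ × ℝ → ℝ} (hw : LpLoc q w) (hh : LpLoc p h) (hφ : Continuous φ)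
    (hφs : HasCompactSupport φ) :
    Tendsto (fun n => ∫ z, φ z * (w z * mollify n h z)) atTop (𝓝 (∫ z, φ z * (w z * h z))) := by
  have hK : IsCompact (tsupport φ) := hφs
  have hres : ∀ f : ℝ × ℝ → ℝ, ∫ z, φ z * f z = ∫ z in tsupport φ, φ z * f z := fun f =>
    (setIntegral_eq_integral_of_forall_compl_eq_zero fun z hz => by
      simp [image_eq_zero_of_notMem_tsupport hz]).symm
  rw [hres]
  simp_rw [hres]
  have hm : ∀ n, LpLoc p (mollify n h) := fun n =>
    .of_continuous (contDiff_mollify n (hh.locallyIntegrable hp1)).continuous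
  have hφw : LpLoc q fun z => φ z * w z := by
    have h0 : LpLoc ⊤ φ := .of_continuous hφ
    exact h0.mul hw
  have hint : ∀ g, LpLoc p g → Integrable (fun z => φ z * (w z * g z))
      (volume.restrict (tsupport φ)) := fun g hg => by
    simp_rw [← mul_assoc]
    exact memLp_one_iff_integrable.1 (LpLoc.mul (r := 1) hφw hg _ hK)
  refine tendsto_integral_of_L1' _ (hint _ hh).1 (Eventually.of_forall fun n => hint _ (hm n)) ?_
  have hlim := tendsto_eLpNorm_mollify_sub hp1 hp hh hK
  have hb : Tendsto (fun n => eLpNorm (fun z => φ z * w z) q (volume.restrict (tsupport φ)) *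
      eLpNorm (mollify n h - h) p (volume.restrict (tsupport φ))) atTop (𝓝 0) := by
    have := ENNReal.Tendsto.const_mul (a := eLpNorm (fun z => φ z * w z) q
      (volume.restrict (tsupport φ))) hlim (Or.inr (hφw _ hK).eLpNorm_ne_top)
    simpa using this
  refine tendsto_of_tendsto_of_tendsto_of_le_of_le tendsto_const_nhds hb
    (fun _ => zero_le) fun n => ?_
  have := eLpNorm_smul_le_mul_eLpNorm (p := q) (q := p) (r := 1) (((hm n) _ hK).sub (hh _ hK)).1 (hφw _ hK).1
  refine le_trans (le_of_eq ?_) this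
  congr 1
  ext z
  simp only [Pi.sub_apply, Pi.smul_apply', smul_eq_mul]
  ring

theorem fderiv_mul_apply {φ f : ℝ × ℝ → ℝ} (hφ : ContDiff ℝ ∞ φ) (hf : ContDiff ℝ ∞ f)
    (z e : ℝ × ℝ) : fderiv ℝ (fun z => φ z * f z) z e =
      fderiv ℝ φ z e * f z + φ z * fderiv ℝ f z e := by
  rw [fderiv_fun_mul (hφ.differentiable (by simp) z) (hf.differentiable (by simp) z)]
  simp only [add_apply, smul_apply, smul_eq_mul]
  ring

theorem contDiff_fderiv_apply {φ : ℝ × ℝ → ℝ} (hφ : ContDiff ℝ ∞ φ) (e : ℝ × ℝ) :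
    ContDiff ℝ ∞ fun z => fderiv ℝ φ z e :=
  (hφ.fderiv_right (m := ∞) (by simp)).clm_apply contDiff_const

theorem hasCompactSupport_fderiv_apply {φ : ℝ × ℝ → ℝ} (hφ : HasCompactSupport φ) (e : ℝ × ℝ) :
    HasCompactSupport fun z => fderiv ℝ φ z e :=
  hφ.fderiv_apply (𝕜 := ℝ) e

/-- The product rule for weak derivatives. -/
theorem IsWeakDeriv.mul {a b c d : ℝ≥0∞} [ENNReal.HolderTriple a c 1]
    [ENNReal.HolderTriple b d 1] (hc1 : 1 ≤ c) (hc : c ≠ ⊤) (hd1 : 1 ≤ d) (hd : d ≠ ⊤)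
    {e : ℝ × ℝ} {f f' g g' : ℝ × ℝ → ℝ} (h : IsWeakDeriv e f f') (k : IsWeakDeriv e g g')
    (hfd : LpLoc b f) (hf : LpLoc a f) (hf' : LpLoc b f') (hg : LpLoc d g)
    (hgc : LpLoc c g) (hg' : LpLoc c g') :
    IsWeakDeriv e (fun z => f z * g z) fun z => f' z * g z + f z * g' z where
  locallyIntegrable := (LpLoc.mul (r := 1) hf hgc).locallyIntegrable le_rfl
  locallyIntegrable_deriv :=
    ((LpLoc.mul (r := 1) hf' hg).add (LpLoc.mul (r := 1) hf hg')).locallyIntegrable le_rfl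
  integral_eq φ hφ hφs := by
    have hφe := contDiff_fderiv_apply hφ e
    have hφes := hasCompactSupport_fderiv_apply hφs e
    have i2 := integrable_mul_of_hasCompactSupport
      ((LpLoc.mul (r := 1) hf' hg).locallyIntegrable le_rfl) hφ.continuous hφs
    have i3 := integrable_mul_of_hasCompactSupport
      ((LpLoc.mul (r := 1) hf hg').locallyIntegrable le_rfl) hφ.continuous hφs
    have t1 := tendsto_integral_mul_mollify hd1 hd hfd hg hφe.continuous hφes
    have t2 := tendsto_integral_mul_mollify hd1 hd hf' hg hφ.continuous hφs
    have t3 := tendsto_integral_mul_mollify hc1 hc hf hg' hφ.continuous hφs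
    -- Only `g` is mollified: then `φ · mollify n g` is a test function for the weak derivative of
    -- `f`.
    have key : ∀ n, ∫ z, fderiv ℝ φ z e * (f z * mollify n g z) =
        -((∫ z, φ z * (f' z * mollify n g z)) + ∫ z, φ z * (f z * mollify n g' z)) := by
      intro n
      have hs := contDiff_mollify n k.locallyIntegrable
      have hs' := contDiff_mollify n k.locallyIntegrable_deriv
      have hw := h.integral_eq (fun z => φ z * mollify n g z) (hφ.mul hs) hφs.mul_right
      simp only [fderiv_mul_apply hφ hs, fderiv_mollify n k, smul_eq_mul, add_mul] at hw
      have j1 : Integrable fun z => fderiv ℝ φ z e * mollify n g z * f z :=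
        integrable_mul_of_hasCompactSupport h.locallyIntegrable
          (hφe.mul hs).continuous hφes.mul_right
      have j2 : Integrable fun z => φ z * mollify n g' z * f z :=
        integrable_mul_of_hasCompactSupport h.locallyIntegrable
          (hφ.mul hs').continuous hφs.mul_right
      rw [integral_add j1 j2] at hw
      have r1 : ∫ z, fderiv ℝ φ z e * (f z * mollify n g z) =
          ∫ z, fderiv ℝ φ z e * mollify n g z * f z := by congr 1; ext z; ring
      have r2 : ∫ z, φ z * (f z * mollify n g' z) =
          ∫ z, φ z * mollify n g' z * f z := by congr 1; ext z; ring
      have r3 : ∫ z, φ z * (f' z * mollify n g z) =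
          ∫ z, φ z * mollify n g z * f' z := by congr 1; ext z; ring
      rw [r1, r2, r3]
      linarith
    simp_rw [key] at t1
    have := tendsto_nhds_unique t1 (t2.add t3).neg
    simp only [smul_eq_mul, mul_add]
    rw [integral_add i2 i3]
    exact this

/-- The Jacobian `∂₁f ∂₂g - ∂₂f ∂₁g` is the weak curl of `f ∇g`. -/
theorem integral_jacobian {e₁ e₂ : ℝ × ℝ} {f f₁ f₂ g g₁ g₂ : ℝ × ℝ → ℝ}
    (hf₁ : IsWeakDeriv e₁ f f₁) (hf₂ : IsWeakDeriv e₂ f f₂)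
    (hg₁ : IsWeakDeriv e₁ g g₁) (hg₂ : IsWeakDeriv e₂ g g₂)
    (lf : LpLoc 2 f) (lf₁ : LpLoc 2 f₁) (lf₂ : LpLoc 2 f₂)
    (lg₁ : LpLoc 2 g₁) (lg₂ : LpLoc 2 g₂)
    {φ : ℝ × ℝ → ℝ} (hφ : ContDiff ℝ ∞ φ) (hφs : HasCompactSupport φ) :
    (∫ z, fderiv ℝ φ z e₁ * (g₂ z * f z)) - ∫ z, fderiv ℝ φ z e₂ * (g₁ z * f z) =
      -((∫ z, φ z * (g₂ z * f₁ z)) - ∫ z, φ z * (g₁ z * f₂ z)) := by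
  have one_le : (1 : ℝ≥0∞) ≤ 2 := by norm_num
  have h1 := contDiff_fderiv_apply hφ e₁
  have h1s := hasCompactSupport_fderiv_apply hφs e₁
  have h2 := contDiff_fderiv_apply hφ e₂
  have h2s := hasCompactSupport_fderiv_apply hφs e₂
  have t1 := tendsto_integral_mul_mollify one_le (by simp) lg₂ lf h1.continuous h1s
  have t2 := tendsto_integral_mul_mollify one_le (by simp) lg₁ lf h2.continuous h2s
  have t3 := tendsto_integral_mul_mollify one_le (by simp) lg₂ lf₁ hφ.continuous hφs
  have t4 := tendsto_integral_mul_mollify one_le (by simp) lg₁ lf₂ hφ.continuous hφs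
  refine tendsto_nhds_unique ((t1.sub t2).congr fun n => ?_) (t3.sub t4).neg
  have hs := contDiff_mollify n hf₁.locallyIntegrable
  have hs1 := contDiff_mollify n hf₁.locallyIntegrable_deriv
  have hs2 := contDiff_mollify n hf₂.locallyIntegrable_deriv
  -- Here `f` is the mollified factor. Testing the derivatives of `g` against `∂₂ψ` and `∂₁ψ`
  -- produces the same mixed second derivative of `ψ` twice, so no second derivative of `g` is
  -- needed.
  set ψ : ℝ × ℝ → ℝ := fun z => φ z * mollify n f z with hψdef
  have hψ : ContDiff ℝ ∞ ψ := hφ.mul hs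
  have hψs : HasCompactSupport ψ := hφs.mul_right
  have w1 := hg₁.integral_eq _ (contDiff_fderiv_apply hψ e₂) (hasCompactSupport_fderiv_apply hψs e₂)
  have w2 := hg₂.integral_eq _ (contDiff_fderiv_apply hψ e₁) (hasCompactSupport_fderiv_apply hψs e₁)
  have hsymm : ∀ z, fderiv ℝ (fun z => fderiv ℝ ψ z e₂) z e₁ =
      fderiv ℝ (fun z => fderiv ℝ ψ z e₁) z e₂ := by
    intro z
    have hd : DifferentiableAt ℝ (fderiv ℝ ψ) z :=
      (hψ.fderiv_right (m := ∞) (by simp)).differentiable (by simp) z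
    rw [fderiv_clm_apply hd (differentiableAt_const _),
      fderiv_clm_apply hd (differentiableAt_const _)]
    have := (hψ.contDiffAt (x := z)).isSymmSndFDerivAt
      (by simpa using WithTop.coe_le_coe.2 (le_top : (2 : ℕ∞) ≤ ⊤))
    simpa using this.eq e₁ e₂
  simp only [hsymm] at w1
  have w := w1.symm.trans w2
  have d1 : ∀ z, fderiv ℝ ψ z e₁ = fderiv ℝ φ z e₁ * mollify n f z + φ z * mollify n f₁ z :=
    fun z => by rw [hψdef, fderiv_mul_apply hφ hs, fderiv_mollify n hf₁]
  have d2 : ∀ z, fderiv ℝ ψ z e₂ = fderiv ℝ φ z e₂ * mollify n f z + φ z * mollify n f₂ z :=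
    fun z => by rw [hψdef, fderiv_mul_apply hφ hs, fderiv_mollify n hf₂]
  simp only [d1, d2, smul_eq_mul, add_mul] at w
  rw [integral_add (integrable_mul_of_hasCompactSupport (hg₁.locallyIntegrable_deriv)
      (h2.mul hs).continuous h2s.mul_right)
    (integrable_mul_of_hasCompactSupport (hg₁.locallyIntegrable_deriv)
      (hφ.mul hs2).continuous hφs.mul_right),
    integral_add (integrable_mul_of_hasCompactSupport (hg₂.locallyIntegrable_deriv)
      (h1.mul hs).continuous h1s.mul_right)
    (integrable_mul_of_hasCompactSupport (hg₂.locallyIntegrable_deriv)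
      (hφ.mul hs1).continuous hφs.mul_right)] at w
  have r : ∀ (α m k : ℝ × ℝ → ℝ), ∫ z, α z * (m z * k z) = ∫ z, α z * k z * m z :=
    fun α m k => by congr 1; ext z; ring
  simp only [r]
  linarith

end GinzburgLandau

/-! ### Sobolev embedding of `H¹_loc` into `L⁴_loc`. -/

namespace GinzburgLandau

open Filter Topology

theorem norm_clm_le_add (L : ℝ × ℝ →L[ℝ] ℝ) : ‖L‖ ≤ ‖L (1, 0)‖ + ‖L (0, 1)‖ := by
  refine L.opNorm_le_bound (by positivity) fun z => ?_
  have hz : L z = z.1 * L (1, 0) + z.2 * L (0, 1) := by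
    rw [← smul_eq_mul, ← smul_eq_mul, ← map_smul, ← map_smul, ← map_add]
    simp
  have h1 : ‖z.1‖ ≤ ‖z‖ := norm_fst_le z
  have h2 : ‖z.2‖ ≤ ‖z‖ := norm_snd_le z
  calc ‖L z‖ ≤ ‖z.1‖ * ‖L (1, 0)‖ + ‖z.2‖ * ‖L (0, 1)‖ := by
        rw [hz, ← norm_mul, ← norm_mul]; exact norm_add_le _ _
    _ ≤ ‖z‖ * ‖L (1, 0)‖ + ‖z‖ * ‖L (0, 1)‖ := by gcongr
    _ = _ := by ring

theorem exists_eLpNorm_mollify_le {p : ℝ≥0∞} (hp1 : 1 ≤ p) (hp : p ≠ ⊤)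
    {f : ℝ × ℝ → ℝ} (hf : LpLoc p f) {K : Set (ℝ × ℝ)} (hK : IsCompact K) :
    ∃ M : ℝ≥0∞, M ≠ ⊤ ∧
      ∀ᶠ n in atTop, eLpNorm (mollify n f) p (volume.restrict K) ≤ M := by
  refine ⟨1 + eLpNorm f p (volume.restrict K),
    ENNReal.add_ne_top.2 ⟨by simp, (hf K hK).eLpNorm_ne_top⟩, ?_⟩
  have h := (tendsto_eLpNorm_mollify_sub hp1 hp hf hK).eventually (gt_mem_nhds one_pos)
  filter_upwards [h] with n hn
  have hc := (LpLoc.of_continuous (p := p)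
    (contDiff_mollify n (hf.locallyIntegrable hp1)).continuous K hK).1
  calc eLpNorm (mollify n f) p (volume.restrict K)
      = eLpNorm ((mollify n f - f) + f) p (volume.restrict K) := by simp
    _ ≤ _ := eLpNorm_add_le (hc.sub (hf K hK).1) (hf K hK).1 hp1
    _ ≤ _ := by gcongr

theorem exists_eLpNorm_le_eLpNorm_fderiv (q r : NNReal) (hq : 1 ≤ q)
    (hr : (r : ℝ)⁻¹ = (q : ℝ)⁻¹ - 2⁻¹) :
    ∃ C : NNReal, ∀ w : ℝ × ℝ → ℝ, ContDiff ℝ ∞ w → HasCompactSupport w →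
      eLpNorm w r volume ≤ C * eLpNorm (fderiv ℝ w) q volume := by
  refine ⟨eLpNormLESNormFDerivOfEqInnerConst (volume : Measure (ℝ × ℝ)) (q : ℝ),
    fun w hw hws => ?_⟩
  have h2 : Module.finrank ℝ (ℝ × ℝ) = 2 := by simp
  exact eLpNorm_le_eLpNorm_fderiv_of_eq_inner (volume : Measure (ℝ × ℝ))
    (p := q) (p' := r) (hw.of_le (by exact_mod_cast le_top)) hws
    hq (by rw [h2]; norm_num) (by rw [h2, hr]; norm_num)

/-- The Gagliardo-Nirenberg-Sobolev inequality for smooth functions supported in a compact set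
of the plane. -/
theorem exists_eLpNorm_four_le {K : Set (ℝ × ℝ)} (hK : IsCompact K) :
    ∃ C : ℝ≥0∞, C ≠ ⊤ ∧ ∀ w : ℝ × ℝ → ℝ, ContDiff ℝ ∞ w → tsupport w ⊆ K →
      eLpNorm w 4 volume ≤ C * eLpNorm (fderiv ℝ w) 2 (volume.restrict K) := by
  have : IsFiniteMeasure (volume.restrict K) := ⟨by simpa using hK.measure_lt_top⟩
  -- The exponent `2` is critical in the plane. The exponent with Sobolev conjugate `4` is `4/3`,
  -- and Hölder on the compact set passes from `4/3` back to `2`.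
  obtain ⟨q, hq⟩ : ∃ q : NNReal, (q : ℝ) = 4 / 3 := ⟨⟨4 / 3, by norm_num⟩, rfl⟩
  have hq2 : (q : ℝ≥0∞) ≤ 2 := by
    have : q ≤ 2 := by rw [← NNReal.coe_le_coe, hq]; norm_num
    exact_mod_cast this
  set V : ℝ≥0∞ := (volume.restrict K) Set.univ ^ (1 / (q : ℝ≥0∞).toReal - 1 / (2 : ℝ≥0∞).toReal)
    with hV
  have hVtop : V ≠ ⊤ := by
    refine ENNReal.rpow_ne_top_of_nonneg ?_ (measure_ne_top _ _)
    rw [ENNReal.coe_toReal, hq]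
    norm_num
  obtain ⟨r, hr⟩ : ∃ r : NNReal, r = 4 := ⟨4, rfl⟩
  have hr4 : (r : ℝ≥0∞) = 4 := by rw [hr]; norm_num
  obtain ⟨C, hC⟩ := exists_eLpNorm_le_eLpNorm_fderiv q r
    (by rw [← NNReal.coe_le_coe, hq]; norm_num) (by rw [hq, hr]; norm_num)
  refine ⟨C * V, ENNReal.mul_ne_top ENNReal.coe_ne_top hVtop, fun w hw hwK => ?_⟩
  have hws : HasCompactSupport w := hK.of_isClosed_subset (isClosed_tsupport _) hwK
  have h1 : eLpNorm w 4 volume ≤ C * eLpNorm (fderiv ℝ w) q volume := hr4 ▸ hC w hw hws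
  have h2 : eLpNorm (fderiv ℝ w) q (volume.restrict K) = eLpNorm (fderiv ℝ w) q volume := by
    rw [← eLpNorm_norm, ← eLpNorm_norm (fderiv ℝ w)]
    refine eLpNorm_restrict_eq_of_support_subset fun z hz => ?_
    exact hwK (support_fderiv_subset ℝ (by simpa using hz))
  have h3 : eLpNorm (fderiv ℝ w) q (volume.restrict K) ≤
      eLpNorm (fderiv ℝ w) 2 (volume.restrict K) * V :=
    eLpNorm_le_eLpNorm_mul_rpow_measure_univ hq2
      (hw.continuous_fderiv (by simp)).aestronglyMeasurable
  rw [← h2] at h1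
  calc eLpNorm w 4 volume ≤ C * eLpNorm (fderiv ℝ w) q (volume.restrict K) := h1
    _ ≤ C * (eLpNorm (fderiv ℝ w) 2 (volume.restrict K) * V) := mul_le_mul_right h3 _
    _ = C * V * eLpNorm (fderiv ℝ w) 2 (volume.restrict K) := by ring

/-- A form of the Sobolev embedding in the plane: `H¹_loc` functions are of class `L⁴_loc`. -/
theorem LpLoc.four_of_isWeakDeriv {f g₁ g₂ : ℝ × ℝ → ℝ} (hf : LpLoc 2 f) (hg₁ : LpLoc 2 g₁)
    (hg₂ : LpLoc 2 g₂) (h₁ : IsWeakDeriv (1, 0) f g₁) (h₂ : IsWeakDeriv (0, 1) f g₂) :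
    LpLoc 4 f := by
  intro K hK
  have one_le : (1 : ℝ≥0∞) ≤ 2 := by norm_num
  have two_ne : (2 : ℝ≥0∞) ≠ ⊤ := by simp
  obtain ⟨R, hR0, hR⟩ : ∃ R : ℝ, 0 < R ∧ K ⊆ Metric.closedBall 0 R := by
    obtain ⟨R, hR⟩ := hK.isBounded.subset_closedBall 0
    exact ⟨max R 1, by positivity, hR.trans (Metric.closedBall_subset_closedBall (le_max_left _ _))⟩
  -- The cutoff equals `1` on `K`, so the products `χ · mollify n f` are compactly supported and
  -- agree with the mollifications on `K`.
  let χ : ContDiffBump (0 : ℝ × ℝ) := ⟨R, R + 1, hR0, by linarith⟩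
  have hχ : ContDiff ℝ ∞ χ := χ.contDiff
  have hχs : HasCompactSupport χ := χ.hasCompactSupport
  set K₁ := tsupport χ with hK₁def
  have hK₁ : IsCompact K₁ := hχs
  have : IsFiniteMeasure (volume.restrict K₁) := ⟨by simpa using hK₁.measure_lt_top⟩
  have hχK : ∀ x ∈ K, χ x = 1 := fun x hx => χ.one_of_mem_closedBall (hR hx)
  obtain ⟨B, hB⟩ := (hχ.continuous_fderiv (by simp)).bounded_above_of_compact_support
    (hχs.fderiv ℝ)
  have hB0 : 0 ≤ B := (norm_nonneg _).trans (hB 0)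
  let w : ℕ → ℝ × ℝ → ℝ := fun n z => χ z * mollify n f z
  have hsm : ∀ n, ContDiff ℝ ∞ (mollify n f) := fun n =>
    contDiff_mollify n (hf.locallyIntegrable one_le)
  have hw : ∀ n, ContDiff ℝ ∞ (w n) := fun n => hχ.mul (hsm n)
  have hws : ∀ n, HasCompactSupport (w n) := fun n => hχs.mul_right
  let D : ℕ → ℝ × ℝ → ℝ := fun n z =>
    2 * B * ‖mollify n f z‖ + ‖mollify n g₁ z‖ + ‖mollify n g₂ z‖
  have hbound : ∀ n z, ‖fderiv ℝ (w n) z‖ ≤ D n z := by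
    intro n z
    have key : ∀ (e : ℝ × ℝ) (g : ℝ × ℝ → ℝ), ‖e‖ = 1 → IsWeakDeriv e f g →
        ‖fderiv ℝ (w n) z e‖ ≤ B * ‖mollify n f z‖ + ‖mollify n g z‖ := by
      intro e g he hg
      rw [fderiv_mul_apply hχ (hsm n), fderiv_mollify n hg]
      refine (norm_add_le _ _).trans ?_
      rw [norm_mul, norm_mul]
      have h1 : ‖fderiv ℝ χ z e‖ ≤ B := by
        refine ((fderiv ℝ χ z).le_opNorm e).trans ?_
        rw [he, mul_one]; exact hB z
      have h2 : ‖χ z‖ ≤ 1 := by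
        rw [Real.norm_of_nonneg χ.nonneg]; exact χ.le_one
      have := mul_le_mul_of_nonneg_right h1 (norm_nonneg (mollify n f z))
      have := mul_le_mul_of_nonneg_right h2 (norm_nonneg (mollify n g z))
      linarith
    have k1 := key (1, 0) g₁ (by simp [Prod.norm_def]) h₁
    have k2 := key (0, 1) g₂ (by simp [Prod.norm_def]) h₂
    refine (norm_clm_le_add _).trans ?_
    simp only [D]
    linarith
  obtain ⟨M₀, hM₀, b₀⟩ := exists_eLpNorm_mollify_le one_le two_ne hf hK₁
  obtain ⟨M₁, hM₁, b₁⟩ := exists_eLpNorm_mollify_le one_le two_ne hg₁ hK₁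
  obtain ⟨M₂, hM₂, b₂⟩ := exists_eLpNorm_mollify_le one_le two_ne hg₂ hK₁
  obtain ⟨C, hC, hGNS⟩ := exists_eLpNorm_four_le hK₁
  let M : ℝ≥0∞ := C * (ENNReal.ofReal (2 * B) * M₀ + M₁ + M₂)
  have hM : M ≠ ⊤ := by finiteness
  have hev : ∀ᶠ n in atTop, eLpNorm (mollify n f) 4 (volume.restrict K) ≤ M := by
    filter_upwards [b₀, b₁, b₂] with n c₀ c₁ c₂
    have cont : ∀ g, LpLoc 2 g → Continuous (mollify n g) := fun g hg =>
      (contDiff_mollify n (hg.locallyIntegrable one_le)).continuous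
    have m₀ := (cont f hf).norm.aestronglyMeasurable (μ := volume.restrict K₁)
    have m₁ := (cont g₁ hg₁).norm.aestronglyMeasurable (μ := volume.restrict K₁)
    have m₂ := (cont g₂ hg₂).norm.aestronglyMeasurable (μ := volume.restrict K₁)
    have hDle : eLpNorm (D n) 2 (volume.restrict K₁) ≤ ENNReal.ofReal (2 * B) * M₀ + M₁ + M₂ := by
      refine (eLpNorm_add_le ((m₀.const_mul _).add m₁) m₂ one_le).trans ?_
      refine add_le_add ((eLpNorm_add_le (m₀.const_mul _) m₁ one_le).trans (add_le_add ?_ ?_)) ?_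
      · change eLpNorm ((2 * B) • fun z => ‖mollify n f z‖) _ _ ≤ _
        rw [eLpNorm_const_smul, eLpNorm_norm, Real.enorm_of_nonneg (by positivity)]
        gcongr
      · rwa [eLpNorm_norm]
      · rwa [eLpNorm_norm]
    calc eLpNorm (mollify n f) 4 (volume.restrict K) = eLpNorm (w n) 4 (volume.restrict K) := by
          refine eLpNorm_congr_ae ?_
          filter_upwards [ae_restrict_mem hK.measurableSet] with x hx
          simp [w, hχK x hx]
      _ ≤ eLpNorm (w n) 4 volume := eLpNorm_mono_measure _ Measure.restrict_le_self
      _ ≤ C * eLpNorm (fderiv ℝ (w n)) 2 (volume.restrict K₁) :=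
          hGNS _ (hw n) tsupport_mul_subset_left
      _ ≤ M := mul_le_mul_right ((eLpNorm_mono_real (hbound n)).trans hDle) C
  -- The mollifications are eventually bounded in `L⁴(K)` and converge in `L²(K)`, hence almost
  -- everywhere along a subsequence. Fatou's lemma then bounds the limit in `L⁴(K)`.
  have htm := tendstoInMeasure_of_tendsto_eLpNorm (p := 2) (by simp)
    (fun n => (LpLoc.of_continuous (p := 2) (hsm n).continuous K hK).1) (hf K hK).1
    (tendsto_eLpNorm_mollify_sub one_le two_ne hf hK)
  obtain ⟨ns, hns, hlim⟩ := htm.exists_seq_tendsto_ae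
  refine ⟨(hf K hK).1, ?_⟩
  have hle := Lp.eLpNorm_lim_le_liminf_eLpNorm (p := 4)
    (fun n => (LpLoc.of_continuous (p := 4) (hsm (ns n)).continuous K hK).1) f hlim
  refine lt_of_le_of_lt (hle.trans ?_) hM.lt_top
  refine liminf_le_of_frequently_le' ?_
  exact (hns.tendsto_atTop.eventually hev).frequently

end GinzburgLandau

/-! ### Calculus of weak derivatives for vector-valued functions. -/

namespace GinzburgLandau

open Filter Topology

section L2Loc

variable {F : Type*} [NormedAddCommGroup F] {f f' : ℝ × ℝ → F}

theorem locallyIntegrable_comp_add_right (h : LocallyIntegrable f volume) (v : ℝ × ℝ) :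
    LocallyIntegrable (fun z => f (z + v)) volume := by
  rw [locallyIntegrable_iff] at h ⊢
  intro K hK
  have hm := (measurePreserving_add_right (volume : Measure (ℝ × ℝ)) v)
  have := (hm.integrableOn_comp_preimage (s := (fun z => z + v) '' K) (f := f)
    (measurableEmbedding_addRight v)).2 (h _ (hK.image (by fun_prop)))
  rwa [Set.preimage_image_eq _ (add_left_injective v)] at this

theorem L2Loc.congr (h : L2Loc f) (hf : f =ᵐ[volume] f') : L2Loc f' :=
  fun K hK => (h K hK).ae_eq (ae_restrict_of_ae hf)

theorem L2Loc.of_continuous (hf : Continuous f) : L2Loc f := by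
  intro K hK
  have : IsFiniteMeasure (volume.restrict K) := ⟨by simpa using hK.measure_lt_top⟩
  obtain ⟨C, hC⟩ := hK.exists_bound_of_continuousOn hf.continuousOn
  exact MemLp.of_bound hf.aestronglyMeasurable C
    ((ae_restrict_iff' hK.measurableSet).2 (Eventually.of_forall hC))

end L2Loc

section WeakDeriv

variable {F G : Type*} [NormedAddCommGroup F] [NormedSpace ℝ F] [NormedAddCommGroup G]
  [NormedSpace ℝ G] {e : ℝ × ℝ} {f g f' g' : ℝ × ℝ → F}

theorem integrable_smul_of_hasCompactSupport {φ : ℝ × ℝ → ℝ} (hf : LocallyIntegrable f volume)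
    (hφ : Continuous φ) (hφs : HasCompactSupport φ) : Integrable fun z => φ z • f z :=
  hf.integrable_smul_left_of_hasCompactSupport hφ hφs

theorem IsWeakDeriv.ae_eq [CompleteSpace F] (h : IsWeakDeriv e f g) (h' : IsWeakDeriv e f g') :
    g =ᵐ[volume] g' :=
  ae_eq_of_integral_contDiff_smul_eq h.locallyIntegrable_deriv h'.locallyIntegrable_deriv
    fun φ hφ hφs => neg_injective <|
      (h.integral_eq φ hφ hφs).symm.trans (h'.integral_eq φ hφ hφs)

theorem isWeakDeriv_weakDeriv (h : ∃ g, IsWeakDeriv e f g) :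
    IsWeakDeriv e f (weakDeriv e f) := by
  rw [weakDeriv, dif_pos h]
  exact h.choose_spec

theorem IsWeakDeriv.weakDeriv_ae_eq [CompleteSpace F] (h : IsWeakDeriv e f g) :
    weakDeriv e f =ᵐ[volume] g :=
  (isWeakDeriv_weakDeriv ⟨g, h⟩).ae_eq h

theorem IsWeakDeriv.congr (h : IsWeakDeriv e f g) (hf : f =ᵐ[volume] f')
    (hg : g =ᵐ[volume] g') : IsWeakDeriv e f' g' where
  locallyIntegrable := h.locallyIntegrable.congr hf
  locallyIntegrable_deriv := h.locallyIntegrable_deriv.congr hg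
  integral_eq φ hφ hφs := by
    have e1 : ∫ z, fderiv ℝ φ z e • f' z = ∫ z, fderiv ℝ φ z e • f z :=
      integral_congr_ae (hf.mono fun z hz => by simp [hz])
    have e2 : ∫ z, φ z • g' z = ∫ z, φ z • g z :=
      integral_congr_ae (hg.mono fun z hz => by simp [hz])
    rw [e1, e2, h.integral_eq φ hφ hφs]

theorem IsWeakDeriv.add (h : IsWeakDeriv e f g) (h' : IsWeakDeriv e f' g') :
    IsWeakDeriv e (fun z => f z + f' z) fun z => g z + g' z where
  locallyIntegrable := h.locallyIntegrable.add h'.locallyIntegrable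
  locallyIntegrable_deriv := h.locallyIntegrable_deriv.add h'.locallyIntegrable_deriv
  integral_eq φ hφ hφs := by
    have c := (contDiff_fderiv_apply hφ e).continuous
    have s := hasCompactSupport_fderiv_apply hφs e
    simp only [smul_add]
    rw [integral_add (integrable_smul_of_hasCompactSupport h.locallyIntegrable c s)
      (integrable_smul_of_hasCompactSupport h'.locallyIntegrable c s),
      integral_add
        (integrable_smul_of_hasCompactSupport h.locallyIntegrable_deriv hφ.continuous hφs)
        (integrable_smul_of_hasCompactSupport h'.locallyIntegrable_deriv hφ.continuous hφs),
      h.integral_eq φ hφ hφs, h'.integral_eq φ hφ hφs, neg_add]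

theorem locallyIntegrable_clm_comp (L : F →L[ℝ] G) (h : LocallyIntegrable f volume) :
    LocallyIntegrable (fun z => L (f z)) volume :=
  locallyIntegrable_iff.2 fun K hK => L.integrable_comp (locallyIntegrable_iff.1 h K hK)

theorem IsWeakDeriv.clm_comp [CompleteSpace F] [CompleteSpace G] (L : F →L[ℝ] G)
    (h : IsWeakDeriv e f g) :
    IsWeakDeriv e (fun z => L (f z)) fun z => L (g z) where
  locallyIntegrable := locallyIntegrable_clm_comp L h.locallyIntegrable
  locallyIntegrable_deriv := locallyIntegrable_clm_comp L h.locallyIntegrable_deriv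
  integral_eq φ hφ hφs := by
    simp only [← map_smul]
    rw [L.integral_comp_comm (integrable_smul_of_hasCompactSupport h.locallyIntegrable
        (contDiff_fderiv_apply hφ e).continuous (hasCompactSupport_fderiv_apply hφs e)),
      L.integral_comp_comm (integrable_smul_of_hasCompactSupport h.locallyIntegrable_deriv
        hφ.continuous hφs), h.integral_eq φ hφ hφs, map_neg]

theorem locallyIntegrable_continuous_smul {c : ℝ × ℝ → ℝ} (hc : Continuous c)
    (h : LocallyIntegrable f volume) : LocallyIntegrable (fun z => c z • f z) volume :=
  locallyIntegrable_iff.2 fun K hK =>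
    (locallyIntegrable_iff.1 h K hK).continuousOn_smul hc.continuousOn hK

/-- With a smooth coefficient `c`, the product `φ c` is again a test function, so no mollification
and no integrability beyond `L¹_loc` are needed. -/
theorem IsWeakDeriv.smooth_smul {c : ℝ × ℝ → ℝ} (hc : ContDiff ℝ ∞ c) (h : IsWeakDeriv e f g) :
    IsWeakDeriv e (fun z => c z • f z) fun z => fderiv ℝ c z e • f z + c z • g z where
  locallyIntegrable := locallyIntegrable_continuous_smul hc.continuous h.locallyIntegrable
  locallyIntegrable_deriv :=
    (locallyIntegrable_continuous_smul (contDiff_fderiv_apply hc e).continuous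
      h.locallyIntegrable).add
      (locallyIntegrable_continuous_smul hc.continuous h.locallyIntegrable_deriv)
  integral_eq φ hφ hφs := by
    have hc' := contDiff_fderiv_apply hc e
    have hφ' := contDiff_fderiv_apply hφ e
    have hφs' := hasCompactSupport_fderiv_apply hφs e
    have hw := h.integral_eq (fun z => φ z * c z) (hφ.mul hc) hφs.mul_right
    simp only [fderiv_mul_apply hφ hc, add_smul] at hw
    have i1 : Integrable fun z => (fderiv ℝ φ z e * c z) • f z :=
      integrable_smul_of_hasCompactSupport h.locallyIntegrable (hφ'.mul hc).continuous
        hφs'.mul_right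
    have i2 : Integrable fun z => (φ z * fderiv ℝ c z e) • f z :=
      integrable_smul_of_hasCompactSupport h.locallyIntegrable (hφ.mul hc').continuous
        hφs.mul_right
    have i3 : Integrable fun z => (φ z * c z) • g z :=
      integrable_smul_of_hasCompactSupport h.locallyIntegrable_deriv (hφ.mul hc).continuous
        hφs.mul_right
    rw [integral_add i1 i2] at hw
    simp only [smul_add, ← mul_smul]
    rw [integral_add i2 i3, neg_add, ← hw]
    abel

theorem IsWeakDeriv.comp_add_right (h : IsWeakDeriv e f g) (v : ℝ × ℝ) :
    IsWeakDeriv e (fun z => f (z + v)) fun z => g (z + v) where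
  locallyIntegrable := locallyIntegrable_comp_add_right h.locallyIntegrable v
  locallyIntegrable_deriv := locallyIntegrable_comp_add_right h.locallyIntegrable_deriv v
  integral_eq φ hφ hφs := by
    have hw := h.integral_eq (fun z => φ (z - v)) (hφ.comp (contDiff_id.sub contDiff_const))
      (hφs.comp_homeomorph (Homeomorph.subRight v))
    simp only [fderiv_comp_sub] at hw
    rw [← integral_add_right_eq_self _ v, ← integral_add_right_eq_self (fun z => φ (z - v) • g z) v]
      at hw
    simpa using hw

theorem isWeakDeriv_of_contDiff [CompleteSpace F] (hf : ContDiff ℝ ∞ f) (e : ℝ × ℝ) :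
    IsWeakDeriv e f fun z => fderiv ℝ f z e where
  locallyIntegrable := hf.continuous.locallyIntegrable
  locallyIntegrable_deriv :=
    ((hf.continuous_fderiv (by simp)).clm_apply continuous_const).locallyIntegrable
  integral_eq φ hφ hφs := by
    have cf : Continuous fun z => fderiv ℝ f z e :=
      (hf.continuous_fderiv (by simp)).clm_apply continuous_const
    have := integral_smul_fderiv_eq_neg_fderiv_smul_of_integrable (μ := volume) (f := φ) (g := f)
      (v := e)
      (integrable_smul_of_hasCompactSupport hf.continuous.locallyIntegrable
        (contDiff_fderiv_apply hφ e).continuous (hasCompactSupport_fderiv_apply hφs e))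
      (integrable_smul_of_hasCompactSupport cf.locallyIntegrable hφ.continuous hφs)
      (integrable_smul_of_hasCompactSupport hf.continuous.locallyIntegrable hφ.continuous hφs)
      (fun x _ => hφ.differentiable (by simp) x) (fun x _ => hf.differentiable (by simp) x)
    rw [this, neg_neg]

theorem L2Loc.clm_comp (L : F →L[ℝ] G) (h : L2Loc f) : L2Loc fun z => L (f z) :=
  fun K hK => L.comp_memLp' (h K hK)

theorem H1Loc.isWeakDeriv_dx (h : H1Loc f) : IsWeakDeriv (1, 0) f (dx f) :=
  isWeakDeriv_weakDeriv (h.exists_dx.imp fun _ h => h.2)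

theorem H1Loc.isWeakDeriv_dy (h : H1Loc f) : IsWeakDeriv (0, 1) f (dy f) :=
  isWeakDeriv_weakDeriv (h.exists_dy.imp fun _ h => h.2)

theorem H1Loc.l2Loc_dx [CompleteSpace F] (h : H1Loc f) : L2Loc (dx f) := by
  obtain ⟨g, hg, hw⟩ := h.exists_dx
  exact hg.congr hw.weakDeriv_ae_eq.symm

theorem H1Loc.l2Loc_dy [CompleteSpace F] (h : H1Loc f) : L2Loc (dy f) := by
  obtain ⟨g, hg, hw⟩ := h.exists_dy
  exact hg.congr hw.weakDeriv_ae_eq.symm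

theorem H1Loc.of_contDiff [CompleteSpace F] (hf : ContDiff ℝ ∞ f) : H1Loc f where
  l2Loc := .of_continuous hf.continuous
  exists_dx := ⟨_, .of_continuous ((hf.continuous_fderiv (by simp)).clm_apply continuous_const),
    isWeakDeriv_of_contDiff hf _⟩
  exists_dy := ⟨_, .of_continuous ((hf.continuous_fderiv (by simp)).clm_apply continuous_const),
    isWeakDeriv_of_contDiff hf _⟩

theorem H1Loc.clm_comp [CompleteSpace F] [CompleteSpace G] (L : F →L[ℝ] G) (h : H1Loc f) :
    H1Loc fun z => L (f z) where
  l2Loc := h.l2Loc.clm_comp L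
  exists_dx := ⟨_, h.l2Loc_dx.clm_comp L, h.isWeakDeriv_dx.clm_comp L⟩
  exists_dy := ⟨_, h.l2Loc_dy.clm_comp L, h.isWeakDeriv_dy.clm_comp L⟩

theorem H1Loc.add [CompleteSpace F] (h : H1Loc f) (h' : H1Loc f') :
    H1Loc fun z => f z + f' z where
  l2Loc K hK := (h.l2Loc K hK).add (h'.l2Loc K hK)
  exists_dx := ⟨_, fun K hK => (h.l2Loc_dx K hK).add (h'.l2Loc_dx K hK),
    h.isWeakDeriv_dx.add h'.isWeakDeriv_dx⟩
  exists_dy := ⟨_, fun K hK => (h.l2Loc_dy K hK).add (h'.l2Loc_dy K hK),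
    h.isWeakDeriv_dy.add h'.isWeakDeriv_dy⟩

end WeakDeriv

theorem H1Loc.lpLoc_four {f : ℝ × ℝ → ℝ} (h : H1Loc f) : LpLoc 4 f :=
  LpLoc.four_of_isWeakDeriv h.l2Loc h.l2Loc_dx h.l2Loc_dy h.isWeakDeriv_dx h.isWeakDeriv_dy

end GinzburgLandau

/-! ### Periodic functions and averaging over the cell. -/

namespace GinzburgLandau

open Filter Topology Convolution Pointwise

section Periodic

variable {b : Module.Basis (Fin 2) ℝ (ℝ × ℝ)}

/-- `f` is almost everywhere periodic with respect to the lattice spanned by `b`. -/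
def AEPeriodic {F : Type*} (b : Module.Basis (Fin 2) ℝ (ℝ × ℝ)) (f : ℝ × ℝ → F) : Prop :=
  ∀ v ∈ Submodule.span ℤ (Set.range b), ∀ᵐ z : ℝ × ℝ, f (z + v) = f z

/-- The almost everywhere periods of a function form an additive subgroup, because translations
preserve null sets. -/
theorem AEPeriodic.of_basis {F : Type*} {f : ℝ × ℝ → F}
    (h : ∀ j, ∀ᵐ z : ℝ × ℝ, f (z + b j) = f z) : AEPeriodic b f := by
  let S : AddSubgroup (ℝ × ℝ) :=
    { carrier := {v | ∀ᵐ z : ℝ × ℝ, f (z + v) = f z}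
      zero_mem' := by simp
      add_mem' := by
        intro v w hv hw
        have hv' := (measurePreserving_add_right (volume : Measure (ℝ × ℝ)) w
          |>.quasiMeasurePreserving).ae hv
        simp only [Set.mem_ofPred_eq]
        filter_upwards [hv', hw] with z h1 h2
        rw [← h2, ← h1, add_assoc, add_comm w v]
      neg_mem' := by
        intro v hv
        have hv' := (measurePreserving_add_right (volume : Measure (ℝ × ℝ)) (-v)
          |>.quasiMeasurePreserving).ae hv
        simp only [Set.mem_ofPred_eq]
        filter_upwards [hv'] with z h1
        rw [← h1]; simp }
  have hle : Submodule.span ℤ (Set.range b) ≤ AddSubgroup.toIntSubmodule S := by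
    rw [Submodule.span_le]
    rintro _ ⟨j, rfl⟩
    exact h j
  exact fun v hv => hle hv

/-- The lattice is countable, so the exceptional null sets can be united. The result is a
representative that is periodic at every point, as the theory of fundamental domains requires. -/
theorem AEPeriodic.comp_fract_ae_eq {F : Type*} {f : ℝ × ℝ → F} (hf : AEPeriodic b f) :
    (fun z => f (ZSpan.fract b z)) =ᵐ[volume] f := by
  have : ∀ᵐ z : ℝ × ℝ, ∀ v : Submodule.span ℤ (Set.range b), f (z + v) = f z :=
    ae_all_iff.2 fun v => hf v v.2
  filter_upwards [this] with z hz
  rw [ZSpan.fract_apply, sub_eq_add_neg, ← hz (-(ZSpan.floor b z))]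
  simp

/-- The translate `y + Ω` is another fundamental domain of the same lattice, and its indicator at
`z` is that of `Ω` at `z - y`. -/
theorem AEPeriodic.setIntegral_translate {f : ℝ × ℝ → ℝ} (hf : AEPeriodic b f) (y : ℝ × ℝ) :
    ∫ z, f z * (ZSpan.fundamentalDomain b).indicator 1 (z - y) =
      ∫ z in ZSpan.fundamentalDomain b, f z := by
  have : Countable (Submodule.span ℤ (Set.range b)).toAddSubgroup :=
    inferInstanceAs (Countable (Submodule.span ℤ (Set.range b)))
  have hD := ZSpan.isAddFundamentalDomain' b (volume : Measure (ℝ × ℝ))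
  have hD' := hD.vadd_of_comm y
  have hm := ZSpan.fundamentalDomain_measurableSet b
  have e1 : ∀ t : Set (ℝ × ℝ), ∫ z in t, f z = ∫ z in t, f (ZSpan.fract b z) := fun t =>
    integral_congr_ae (ae_restrict_of_ae hf.comp_fract_ae_eq.symm)
  have e2 := hD.setIntegral_eq hD' (f := fun z => f (ZSpan.fract b z)) (fun g x => by
    congr 1
    exact ZSpan.fract_zSpan_add b x g.2)
  rw [e1, e2, ← e1, ← integral_indicator (hm.const_vadd y)]
  refine integral_congr_ae (Eventually.of_forall fun z => ?_)
  by_cases hz : z - y ∈ ZSpan.fundamentalDomain b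
  · have : z ∈ y +ᵥ ZSpan.fundamentalDomain b := by
      rw [Set.mem_vadd_set_iff_neg_vadd_mem]; simpa [sub_eq_neg_add] using hz
    simp [hz, this]
  · have : z ∉ y +ᵥ ZSpan.fundamentalDomain b := by
      rw [Set.mem_vadd_set_iff_neg_vadd_mem]; simpa [sub_eq_neg_add] using hz
    simp [hz, this]

theorem isCompact_closure_fundamentalDomain :
    IsCompact (closure (ZSpan.fundamentalDomain b)) :=
  (ZSpan.fundamentalDomain_isBounded b).isCompact_closure

theorem hasCompactSupport_indicator_fundamentalDomain :
    HasCompactSupport ((ZSpan.fundamentalDomain b).indicator (1 : ℝ × ℝ → ℝ)) :=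
  isCompact_closure_fundamentalDomain.of_isClosed_subset (isClosed_tsupport _)
    (closure_mono Set.support_indicator_subset)

theorem locallyIntegrable_indicator_fundamentalDomain :
    LocallyIntegrable ((ZSpan.fundamentalDomain b).indicator (1 : ℝ × ℝ → ℝ)) volume :=
  (locallyIntegrable_const 1).indicator (ZSpan.fundamentalDomain_measurableSet b)

/-- Integrating a periodic function against `1_Ω ⋆ ψ` gives `∫ ψ` times its integral over `Ω`. -/
theorem AEPeriodic.integral_convolution {f ψ : ℝ × ℝ → ℝ} (hf : AEPeriodic b f)
    (hfi : LocallyIntegrable f volume) (hψ : Continuous ψ) (hψs : HasCompactSupport ψ) :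
    ∫ z, ((ZSpan.fundamentalDomain b).indicator (1 : ℝ × ℝ → ℝ)
      ⋆[ContinuousLinearMap.mul ℝ ℝ, volume] ψ) z * f z =
      (∫ y, ψ y) * ∫ z in ZSpan.fundamentalDomain b, f z := by
  set I := (ZSpan.fundamentalDomain b).indicator (1 : ℝ × ℝ → ℝ) with hI
  have hIm : Measurable I :=
    measurable_one.indicator (ZSpan.fundamentalDomain_measurableSet b)
  -- If `ψ y ≠ 0` and `z - y ∈ Ω` then `z ∈ K`. Truncating `f` to the compact set `K` therefore
  -- changes nothing and provides the integrability for Fubini.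
  set K := tsupport ψ + closure (ZSpan.fundamentalDomain b) with hK
  have hKc : IsCompact K := IsCompact.add hψs isCompact_closure_fundamentalDomain
  have hint : Integrable (Function.uncurry fun z y : ℝ × ℝ => I (z - y) * (K.indicator f z * ψ y))
      (volume.prod volume) := by
    have h1 : Integrable (fun a : (ℝ × ℝ) × (ℝ × ℝ) => K.indicator f a.1 * ψ a.2)
        (volume.prod volume) :=
      ((integrable_indicator_iff hKc.measurableSet).2
        (locallyIntegrable_iff.1 hfi K hKc)).mul_prod
        (hψ.integrable_of_hasCompactSupport hψs)
    refine h1.bdd_mul (c := 1) (f := fun a : (ℝ × ℝ) × (ℝ × ℝ) => I (a.1 - a.2))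
      (hIm.comp (measurable_fst.sub measurable_snd)).aestronglyMeasurable
      (Eventually.of_forall fun a => ?_)
    by_cases ha : a.1 - a.2 ∈ ZSpan.fundamentalDomain b <;> simp [hI, ha]
  have hpt : ∀ z y, I (z - y) * (K.indicator f z * ψ y) = I (z - y) * ψ y * f z := by
    intro z y
    by_cases hy : ψ y = 0
    · simp [hy]
    by_cases hzy : z - y ∈ ZSpan.fundamentalDomain b
    · have : z ∈ K := by
        refine ⟨y, subset_tsupport _ hy, z - y, subset_closure hzy, by simp⟩
      rw [Set.indicator_of_mem this]; ring
    · simp [hI, hzy]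
  calc ∫ z, (I ⋆[ContinuousLinearMap.mul ℝ ℝ, volume] ψ) z * f z
      = ∫ z, ∫ y, I (z - y) * (K.indicator f z * ψ y) := by
        refine integral_congr_ae (Eventually.of_forall fun z => ?_)
        simp only [hpt]
        rw [integral_mul_const, convolution_mul_swap]
    _ = ∫ y, ∫ z, I (z - y) * (K.indicator f z * ψ y) := integral_integral_swap hint
    _ = ∫ y, ψ y * ∫ z in ZSpan.fundamentalDomain b, f z := by
        refine integral_congr_ae (Eventually.of_forall fun y => ?_)
        simp only [hpt]
        rw [← hf.setIntegral_translate y, ← integral_const_mul]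
        refine integral_congr_ae (Eventually.of_forall fun z => ?_)
        simp only [hI]; ring
    _ = _ := integral_mul_const _ _

theorem fderiv_convolution_apply {I ρ : ℝ × ℝ → ℝ} (hI : LocallyIntegrable I volume)
    (hρ : ContDiff ℝ ∞ ρ) (hρs : HasCompactSupport ρ) (e z : ℝ × ℝ) :
    fderiv ℝ (I ⋆[ContinuousLinearMap.mul ℝ ℝ, volume] ρ) z e =
      (I ⋆[ContinuousLinearMap.mul ℝ ℝ, volume] fun y => fderiv ℝ ρ y e) z := by
  rw [(hρs.hasFDerivAt_convolution_right (ContinuousLinearMap.mul ℝ ℝ) hI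
    (hρ.of_le (by exact_mod_cast le_top)) z).fderiv,
    convolution_precompR_apply _ hI (hρs.fderiv ℝ) (hρ.continuous_fderiv (by simp))]

theorem integral_fderiv_apply_eq_zero {ρ : ℝ × ℝ → ℝ}
    (hρ : ContDiff ℝ ∞ ρ) (hρs : HasCompactSupport ρ) (e : ℝ × ℝ) :
    ∫ y, fderiv ℝ ρ y e = 0 := by
  have i1 : Integrable fun y => fderiv ℝ ρ y e :=
    (contDiff_fderiv_apply hρ e).continuous.integrable_of_hasCompactSupport
      (hasCompactSupport_fderiv_apply hρs e)
  have i2 : Integrable ρ := hρ.continuous.integrable_of_hasCompactSupport hρs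
  have := integral_mul_fderiv_eq_neg_fderiv_mul_of_integrable (μ := volume) (f := fun _ => (1 : ℝ))
    (g := ρ) (v := e) (by simp) (by simpa using i1) (by simpa using i2)
    (by simp) (fun x _ => hρ.differentiable (by simp) x)
  simpa using this

/-- There is a test function that averages periodic functions over `Ω`. -/
theorem exists_averaging_testFunction (b : Module.Basis (Fin 2) ℝ (ℝ × ℝ)) :
    ∃ φ : ℝ × ℝ → ℝ, ContDiff ℝ ∞ φ ∧ HasCompactSupport φ ∧
      ∀ f : ℝ × ℝ → ℝ, AEPeriodic b f → LocallyIntegrable f volume →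
        ∫ z, φ z * f z = ∫ z in ZSpan.fundamentalDomain b, f z ∧
          ∀ e, ∫ z, fderiv ℝ φ z e * f z = 0 := by
  obtain ⟨ρ, hρ, hρs, hρ1⟩ : ∃ ρ : ℝ × ℝ → ℝ,
      ContDiff ℝ ∞ ρ ∧ HasCompactSupport ρ ∧ ∫ y, ρ y = 1 :=
    ⟨kernel 0, contDiff_kernel 0, hasCompactSupport_kernel 0, integral_kernel 0⟩
  -- Against `1_Ω ⋆ ψ` a periodic function gives `∫ ψ` times its integral over `Ω`. This factor is
  -- `1` for `ψ = ρ` and `0` for a derivative of `ρ`.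
  refine ⟨(ZSpan.fundamentalDomain b).indicator (1 : ℝ × ℝ → ℝ)
    ⋆[ContinuousLinearMap.mul ℝ ℝ, volume] ρ,
    hρs.contDiff_convolution_right _ locallyIntegrable_indicator_fundamentalDomain hρ,
    hasCompactSupport_indicator_fundamentalDomain.convolution _ hρs, fun f hf hfi => ⟨?_, ?_⟩⟩
  · rw [hf.integral_convolution hfi hρ.continuous hρs, hρ1, one_mul]
  · intro e
    simp only [fderiv_convolution_apply locallyIntegrable_indicator_fundamentalDomain hρ hρs]
    rw [hf.integral_convolution hfi (contDiff_fderiv_apply hρ e).continuous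
      (hasCompactSupport_fderiv_apply hρs e), integral_fderiv_apply_eq_zero hρ hρs, zero_mul]

/-- A periodic weak curl has mean zero. -/
theorem AEPeriodic.setIntegral_eq_zero {e₁ e₂ : ℝ × ℝ} {f₁ f₂ g : ℝ × ℝ → ℝ}
    (h₁ : AEPeriodic b f₁) (h₂ : AEPeriodic b f₂) (h : AEPeriodic b g)
    (hi₁ : LocallyIntegrable f₁ volume) (hi₂ : LocallyIntegrable f₂ volume)
    (hi : LocallyIntegrable g volume)
    (hw : ∀ φ : ℝ × ℝ → ℝ, ContDiff ℝ ∞ φ → HasCompactSupport φ →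
      (∫ z, fderiv ℝ φ z e₁ * f₁ z) - ∫ z, fderiv ℝ φ z e₂ * f₂ z = -∫ z, φ z * g z) :
    ∫ z in ZSpan.fundamentalDomain b, g z = 0 := by
  obtain ⟨φ, hφ, hφs, hav⟩ := exists_averaging_testFunction b
  have key := hw φ hφ hφs
  rw [(hav f₁ h₁ hi₁).2, (hav f₂ h₂ hi₂).2, (hav g h hi).1] at key
  linarith

end Periodic

end GinzburgLandau

/-! ### Weak curl of the supercurrent, and the phases of the multipliers. -/

namespace GinzburgLandau

open Filter Topology

section LocalIdentity

theorem holderTriple_coe {p q r : NNReal} (hp : p ≠ 0) (hq : q ≠ 0) (hr : r ≠ 0)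
    (h : p⁻¹ + q⁻¹ = r⁻¹) : ENNReal.HolderTriple p q r where
  inv_add_inv_eq_inv := by
    rw [← ENNReal.coe_inv hp, ← ENNReal.coe_inv hq, ← ENNReal.coe_inv hr, ← ENNReal.coe_add, h]

instance holderTriple_four_four : ENNReal.HolderTriple 4 4 2 :=
  holderTriple_coe (p := 4) (q := 4) (r := 2) (by simp) (by simp) (by simp)
    (by rw [← NNReal.coe_inj]; push_cast; norm_num)

instance holderTriple_two_four : ENNReal.HolderTriple 2 4 ((4 / 3 : NNReal) : ℝ≥0∞) :=
  holderTriple_coe (p := 2) (q := 4) (r := 4 / 3) (by simp) (by simp) (by simp)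
    (by rw [← NNReal.coe_inj]; push_cast; norm_num)

instance holderTriple_four_two : ENNReal.HolderTriple 4 2 ((4 / 3 : NNReal) : ℝ≥0∞) :=
  ENNReal.HolderTriple.symm

instance holderTriple_fourThirds_four :
    ENNReal.HolderTriple ((4 / 3 : NNReal) : ℝ≥0∞) 4 1 :=
  holderTriple_coe (p := 4 / 3) (q := 4) (r := 1) (by simp) (by simp) (by simp)
    (by rw [← NNReal.coe_inj]; push_cast; norm_num)

/-- This serves the cubic terms `A |u|²` of the current. The first product lies in `L²` with
derivative in `L^{4/3}`, and `4/3` is conjugate to `4`, so the product rule applies a second time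
with the last factor in `L⁴`. -/
theorem IsWeakDeriv.mul_sq {e : ℝ × ℝ} {f f' g g' : ℝ × ℝ → ℝ} (h : IsWeakDeriv e f f')
    (k : IsWeakDeriv e g g') (hf : LpLoc 4 f) (hf' : LpLoc 2 f') (hg : LpLoc 4 g)
    (hg' : LpLoc 2 g') :
    IsWeakDeriv e (fun z => f z * g z * g z)
      fun z => (f' z * g z + f z * g' z) * g z + f z * g z * g' z := by
  have le24 : (2 : ℝ≥0∞) ≤ 4 := by norm_num
  have le43 : ((4 / 3 : NNReal) : ℝ≥0∞) ≤ 2 := by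
    have : (4 / 3 : NNReal) ≤ 2 := by rw [← NNReal.coe_le_coe]; push_cast; norm_num
    exact_mod_cast this
  have hfg : IsWeakDeriv e (fun z => f z * g z) fun z => f' z * g z + f z * g' z :=
    h.mul (a := 2) (b := 2) (c := 2) (d := 2) (by norm_num) (by simp) (by norm_num) (by simp) k
      (hf.mono_exponent le24) (hf.mono_exponent le24) hf' (hg.mono_exponent le24)
      (hg.mono_exponent le24) hg'
  have l2 : LpLoc 2 fun z => f z * g z := hf.mul hg
  refine hfg.mul (a := 2) (b := ((4 / 3 : NNReal) : ℝ≥0∞)) (c := 2) (d := 4) (by norm_num)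
    (by simp) (by norm_num) (by simp) k (l2.mono_exponent le43) l2 ?_ hg
    (hg.mono_exponent le24) hg'
  exact (hf'.mul hg).add (hf.mul hg')

theorem locallyIntegrable_fun_add {f g : ℝ × ℝ → ℝ} (hf : LocallyIntegrable f volume)
    (hg : LocallyIntegrable g volume) : LocallyIntegrable (fun z => f z + g z) volume := hf.add hg

theorem locallyIntegrable_fun_sub {f g : ℝ × ℝ → ℝ} (hf : LocallyIntegrable f volume)
    (hg : LocallyIntegrable g volume) : LocallyIntegrable (fun z => f z - g z) volume := hf.sub hg

theorem integral_mul_add {φ f g : ℝ × ℝ → ℝ} (hφ : Continuous φ) (hφs : HasCompactSupport φ)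
    (hf : LocallyIntegrable f volume) (hg : LocallyIntegrable g volume) :
    ∫ z, φ z * (f z + g z) = (∫ z, φ z * f z) + ∫ z, φ z * g z := by
  simp only [mul_add]
  exact integral_add (integrable_mul_of_hasCompactSupport hf hφ hφs)
    (integrable_mul_of_hasCompactSupport hg hφ hφs)

theorem integral_mul_sub {φ f g : ℝ × ℝ → ℝ} (hφ : Continuous φ) (hφs : HasCompactSupport φ)
    (hf : LocallyIntegrable f volume) (hg : LocallyIntegrable g volume) :
    ∫ z, φ z * (f z - g z) = (∫ z, φ z * f z) - ∫ z, φ z * g z := by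
  simp only [mul_sub]
  exact integral_sub (integrable_mul_of_hasCompactSupport hf hφ hφs)
    (integrable_mul_of_hasCompactSupport hg hφ hφs)

/-- The weak curl of the supercurrent of `p + i q` in the potential `(A₁, A₂)`. -/
theorem integral_curl_current {e₁ e₂ : ℝ × ℝ}
    {p p₁ p₂ q q₁ q₂ A₁ A₁₂ A₂ A₂₁ : ℝ × ℝ → ℝ}
    (hp₁ : IsWeakDeriv e₁ p p₁) (hp₂ : IsWeakDeriv e₂ p p₂)
    (hq₁ : IsWeakDeriv e₁ q q₁) (hq₂ : IsWeakDeriv e₂ q q₂)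
    (hA₁ : IsWeakDeriv e₂ A₁ A₁₂) (hA₂ : IsWeakDeriv e₁ A₂ A₂₁)
    (lp : LpLoc 4 p) (lp₁ : LpLoc 2 p₁) (lp₂ : LpLoc 2 p₂)
    (lq : LpLoc 4 q) (lq₁ : LpLoc 2 q₁) (lq₂ : LpLoc 2 q₂)
    (lA₁ : LpLoc 4 A₁) (lA₁₂ : LpLoc 2 A₁₂) (lA₂ : LpLoc 4 A₂) (lA₂₁ : LpLoc 2 A₂₁)
    {φ : ℝ × ℝ → ℝ} (hφ : ContDiff ℝ ∞ φ) (hφs : HasCompactSupport φ) :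
    (∫ z, fderiv ℝ φ z e₁ *
        (p₂ z * q z - q₂ z * p z + (A₂ z * p z * p z + A₂ z * q z * q z))) -
      ∫ z, fderiv ℝ φ z e₂ *
        (p₁ z * q z - q₁ z * p z + (A₁ z * p z * p z + A₁ z * q z * q z)) =
      -∫ z, φ z * (2 * (q₁ z * p₂ z - p₁ z * q₂ z) +
        2 * (A₂ z * (p z * p₁ z + q z * q₁ z) - A₁ z * (p z * p₂ z + q z * q₂ z)) +
        (A₂₁ z - A₁₂ z) * (p z ^ 2 + q z ^ 2)) := by
  have le24 : (2 : ℝ≥0∞) ≤ 4 := by norm_num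
  have l22 : ∀ {f g : ℝ × ℝ → ℝ}, LpLoc 2 f → LpLoc 2 g →
      LocallyIntegrable (fun z => f z * g z) volume := fun hf hg =>
    (LpLoc.mul (r := 1) hf hg).locallyIntegrable le_rfl
  have c1 := (contDiff_fderiv_apply hφ e₁).continuous
  have c2 := (contDiff_fderiv_apply hφ e₂).continuous
  have s1 := hasCompactSupport_fderiv_apply hφs e₁
  have s2 := hasCompactSupport_fderiv_apply hφs e₂
  have lp' := lp.mono_exponent le24
  have lq' := lq.mono_exponent le24
  -- The Jacobian identity is used in both orders: the current contains the antisymmetric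
  -- combination `q ∇p - p ∇q`, whose curl is twice a Jacobian.
  have jpq := integral_jacobian hp₁ hp₂ hq₁ hq₂ lp' lp₁ lp₂ lq₁ lq₂ hφ hφs
  have jqp := integral_jacobian hq₁ hq₂ hp₁ hp₂ lq' lq₁ lq₂ lp₁ lp₂ hφ hφs
  have w1 := hA₂.mul_sq hp₁ lA₂ lA₂₁ lp lp₁
  have w2 := hA₂.mul_sq hq₁ lA₂ lA₂₁ lq lq₁
  have w3 := hA₁.mul_sq hp₂ lA₁ lA₁₂ lp lp₂
  have w4 := hA₁.mul_sq hq₂ lA₁ lA₁₂ lq lq₂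
  have v1 := w1.integral_eq φ hφ hφs
  have v2 := w2.integral_eq φ hφ hφs
  have v3 := w3.integral_eq φ hφ hφs
  have v4 := w4.integral_eq φ hφ hφs
  simp only [smul_eq_mul] at v1 v2 v3 v4
  rw [integral_mul_add c1 s1 (locallyIntegrable_fun_sub (l22 lp₂ lq') (l22 lq₂ lp'))
      (locallyIntegrable_fun_add w1.locallyIntegrable w2.locallyIntegrable),
    integral_mul_sub c1 s1 (l22 lp₂ lq') (l22 lq₂ lp'),
    integral_mul_add c1 s1 w1.locallyIntegrable w2.locallyIntegrable,
    integral_mul_add c2 s2 (locallyIntegrable_fun_sub (l22 lp₁ lq') (l22 lq₁ lp'))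
      (locallyIntegrable_fun_add w3.locallyIntegrable w4.locallyIntegrable),
    integral_mul_sub c2 s2 (l22 lp₁ lq') (l22 lq₁ lp'),
    integral_mul_add c2 s2 w3.locallyIntegrable w4.locallyIntegrable, v1, v2, v3, v4]
  -- The right side is regrouped as the terms delivered by the two Jacobians and the four product
  -- rules.
  have hrhs : ∫ z, φ z * (2 * (q₁ z * p₂ z - p₁ z * q₂ z) +
        2 * (A₂ z * (p z * p₁ z + q z * q₁ z) - A₁ z * (p z * p₂ z + q z * q₂ z)) +
        (A₂₁ z - A₁₂ z) * (p z ^ 2 + q z ^ 2)) =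
      ∫ z, φ z * (((p₂ z * q₁ z - p₁ z * q₂ z) - (q₂ z * p₁ z - q₁ z * p₂ z)) +
        ((((A₂₁ z * p z + A₂ z * p₁ z) * p z + A₂ z * p z * p₁ z) +
          ((A₂₁ z * q z + A₂ z * q₁ z) * q z + A₂ z * q z * q₁ z)) -
        (((A₁₂ z * p z + A₁ z * p₂ z) * p z + A₁ z * p z * p₂ z) +
          ((A₁₂ z * q z + A₁ z * q₂ z) * q z + A₁ z * q z * q₂ z)))) := by
    congr 1; ext z; ring
  have c := hφ.continuous
  rw [hrhs, integral_mul_add c hφs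
      (locallyIntegrable_fun_sub (locallyIntegrable_fun_sub (l22 lp₂ lq₁) (l22 lp₁ lq₂))
        (locallyIntegrable_fun_sub (l22 lq₂ lp₁) (l22 lq₁ lp₂)))
      (locallyIntegrable_fun_sub (locallyIntegrable_fun_add w1.locallyIntegrable_deriv w2.locallyIntegrable_deriv)
        (locallyIntegrable_fun_add w3.locallyIntegrable_deriv w4.locallyIntegrable_deriv)),
    integral_mul_sub c hφs (locallyIntegrable_fun_sub (l22 lp₂ lq₁) (l22 lp₁ lq₂)) (locallyIntegrable_fun_sub (l22 lq₂ lp₁) (l22 lq₁ lp₂)),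
    integral_mul_sub c hφs (l22 lp₂ lq₁) (l22 lp₁ lq₂),
    integral_mul_sub c hφs (l22 lq₂ lp₁) (l22 lq₁ lp₂),
    integral_mul_sub c hφs (locallyIntegrable_fun_add w1.locallyIntegrable_deriv w2.locallyIntegrable_deriv)
        (locallyIntegrable_fun_add w3.locallyIntegrable_deriv w4.locallyIntegrable_deriv),
    integral_mul_add c hφs w1.locallyIntegrable_deriv w2.locallyIntegrable_deriv,
    integral_mul_add c hφs w3.locallyIntegrable_deriv w4.locallyIntegrable_deriv]
  linarith

end LocalIdentity

section Covariance

/-- The phase `π (v_x y - v_y x)` of the multiplier of the translation by `v`. -/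
noncomputable def phase (v z : ℝ × ℝ) : ℝ := Real.pi * (v.1 * z.2 - v.2 * z.1)

theorem contDiff_phase (v : ℝ × ℝ) : ContDiff ℝ ∞ (phase v) := by
  unfold phase; fun_prop

theorem hasFDerivAt_phase (v z : ℝ × ℝ) : HasFDerivAt (phase v)
    (Real.pi • (v.1 • ContinuousLinearMap.snd ℝ ℝ ℝ - v.2 • ContinuousLinearMap.fst ℝ ℝ ℝ)) z := by
  unfold phase
  exact ((hasFDerivAt_snd.const_mul v.1).sub (hasFDerivAt_fst.const_mul v.2)).const_mul Real.pi

theorem exp_I_mul_phase (v z : ℝ × ℝ) : Complex.exp (Complex.I * (phase v z : ℂ)) =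
    (Real.cos (phase v z) : ℂ) + (Real.sin (phase v z) : ℂ) * Complex.I := by
  rw [mul_comm, Complex.exp_mul_I, Complex.ofReal_cos, Complex.ofReal_sin]

/-- Splitting the exponential into cosine and sine reduces to real smooth coefficients. The phase is
linear in `z`, so its derivative in the direction `e` is `phase v e`. -/
theorem IsWeakDeriv.exp_phase_mul {e v : ℝ × ℝ} {u g : ℝ × ℝ → ℂ} (h : IsWeakDeriv e u g) :
    IsWeakDeriv e (fun z => Complex.exp (Complex.I * (phase v z : ℂ)) * u z)
      fun z => Complex.exp (Complex.I * (phase v z : ℂ)) *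
        (g z + Complex.I * (phase v e : ℂ) * u z) := by
  have hc : ContDiff ℝ ∞ fun z => Real.cos (phase v z) := Real.contDiff_cos.comp (contDiff_phase v)
  have hs : ContDiff ℝ ∞ fun z => Real.sin (phase v z) := Real.contDiff_sin.comp (contDiff_phase v)
  have hI := h.clm_comp (ContinuousLinearMap.mul ℝ ℂ Complex.I)
  have hsum := (h.smooth_smul hc).add (hI.smooth_smul hs)
  refine hsum.congr (Eventually.of_forall fun z => ?_) (Eventually.of_forall fun z => ?_)
  · simp only [exp_I_mul_phase, Complex.real_smul, ContinuousLinearMap.mul_apply']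
    ring
  · have d1 : fderiv ℝ (fun z => Real.cos (phase v z)) z e =
        -Real.sin (phase v z) * phase v e := by
      rw [(hasFDerivAt_phase v z).cos.fderiv]
      simp [phase]
    have d2 : fderiv ℝ (fun z => Real.sin (phase v z)) z e =
        Real.cos (phase v z) * phase v e := by
      rw [(hasFDerivAt_phase v z).sin.fderiv]
      simp [phase]
    simp only [d1, d2, exp_I_mul_phase, Complex.real_smul, ContinuousLinearMap.mul_apply']
    push_cast
    linear_combination (-(Complex.sin (phase v z)) * (phase v e) * u z) * Complex.I_sq

end Covariance

end GinzburgLandau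

/-! ### Gauge covariance and the Bogomolny inequality. -/

namespace GinzburgLandau

open Filter Topology

variable {b : Module.Basis (Fin 2) ℝ (ℝ × ℝ)} {u : ℝ × ℝ → ℂ} {a : ℝ × ℝ → ℝ × ℝ}

/-- Both sides are weak derivatives of the same function `z ↦ u (z + v)`, and weak derivatives are
unique up to null sets. -/
theorem IsWeakDeriv.ae_comp_add_of_quasiperiodic {e v : ℝ × ℝ} {g : ℝ × ℝ → ℂ}
    (h : IsWeakDeriv e u g)
    (hu : ∀ᵐ z, u (z + v) = Complex.exp (Complex.I * (phase v z : ℂ)) * u z) :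
    ∀ᵐ z, g (z + v) = Complex.exp (Complex.I * (phase v z : ℂ)) *
      (g z + Complex.I * (phase v e : ℂ) * u z) :=
  (h.comp_add_right v).ae_eq
    (h.exp_phase_mul.congr (hu.mono fun _ hz => hz.symm) (Eventually.of_forall fun _ => rfl))

/-- The first component of the total potential. -/
noncomputable def potX (a : ℝ × ℝ → ℝ × ℝ) (z : ℝ × ℝ) : ℝ := (A₀ z).1 + (a z).1

/-- The second component of the total potential. -/
noncomputable def potY (a : ℝ × ℝ → ℝ × ℝ) (z : ℝ × ℝ) : ℝ := (A₀ z).2 + (a z).2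

/-- The covariant derivative `i ∂u/∂x + A_x u`. -/
noncomputable def covX (u : ℝ × ℝ → ℂ) (a : ℝ × ℝ → ℝ × ℝ) (z : ℝ × ℝ) : ℂ :=
  Complex.I * dx u z + (potX a z : ℂ) * u z

/-- The covariant derivative `i ∂u/∂y + A_y u`. -/
noncomputable def covY (u : ℝ × ℝ → ℂ) (a : ℝ × ℝ → ℝ × ℝ) (z : ℝ × ℝ) : ℂ :=
  Complex.I * dy u z + (potY a z : ℂ) * u z

theorem covGradSq_eq (z : ℝ × ℝ) : covGradSq u a z = ‖covX u a z‖ ^ 2 + ‖covY u a z‖ ^ 2 := rfl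

theorem IsSection.quasiperiodic_phase (hu : IsSection b u) (j : Fin 2) :
    ∀ᵐ z, u (z + b j) = Complex.exp (Complex.I * (phase (b j) z : ℂ)) * u z :=
  hu.quasiperiodic j

theorem IsPotential.periodic_basis (ha : IsPotential b a) (j : Fin 2) :
    ∀ᵐ z, a (z + b j) = a z :=
  ha.periodic _ (Submodule.subset_span ⟨j, rfl⟩)

/-- Gauge covariance: differentiating the multiplier adds `π v_y u` to `i ∂u/∂x`, and the
translation by `v` adds `-π v_y` to the first component of `A₀`. The two contributions cancel. -/
theorem ae_covX_add (hu : IsSection b u) (ha : IsPotential b a) (j : Fin 2) :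
    ∀ᵐ z, covX u a (z + b j) = Complex.exp (Complex.I * (phase (b j) z : ℂ)) * covX u a z := by
  filter_upwards [hu.quasiperiodic_phase j, ha.periodic_basis j,
    hu.h1Loc.isWeakDeriv_dx.ae_comp_add_of_quasiperiodic (hu.quasiperiodic_phase j)] with z h1 h2 h3
  simp only [covX, potX, h1, h2, h3, A₀, phase, Prod.snd_add]
  push_cast
  linear_combination (-(Complex.exp (Complex.I * (Real.pi * ((b j).1 * z.2 - (b j).2 * z.1)))) *
    (Real.pi * (b j).2) * u z) * Complex.I_sq

theorem ae_covY_add (hu : IsSection b u) (ha : IsPotential b a) (j : Fin 2) :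
    ∀ᵐ z, covY u a (z + b j) = Complex.exp (Complex.I * (phase (b j) z : ℂ)) * covY u a z := by
  filter_upwards [hu.quasiperiodic_phase j, ha.periodic_basis j,
    hu.h1Loc.isWeakDeriv_dy.ae_comp_add_of_quasiperiodic (hu.quasiperiodic_phase j)] with z h1 h2 h3
  simp only [covY, potY, h1, h2, h3, A₀, phase, Prod.fst_add]
  push_cast
  linear_combination ((Complex.exp (Complex.I * (Real.pi * ((b j).1 * z.2 - (b j).2 * z.1)))) *
    (Real.pi * (b j).1) * u z) * Complex.I_sq

theorem normSq_exp_I_mul (t : ℝ) : Complex.normSq (Complex.exp (Complex.I * (t : ℂ))) = 1 := by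
  rw [Complex.normSq_eq_norm_sq, mul_comm, Complex.norm_exp_ofReal_mul_I]; norm_num

/-- Products `w₁ * conj w₂` of quasiperiodic functions are periodic. -/
theorem aePeriodic_mul_conj {w₁ w₂ : ℝ × ℝ → ℂ}
    (h₁ : ∀ j, ∀ᵐ z, w₁ (z + b j) = Complex.exp (Complex.I * (phase (b j) z : ℂ)) * w₁ z)
    (h₂ : ∀ j, ∀ᵐ z, w₂ (z + b j) = Complex.exp (Complex.I * (phase (b j) z : ℂ)) * w₂ z) :
    AEPeriodic b fun z => w₁ z * (starRingEnd ℂ) (w₂ z) := by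
  refine AEPeriodic.of_basis fun j => ?_
  filter_upwards [h₁ j, h₂ j] with z k1 k2
  have := normSq_exp_I_mul (phase (b j) z)
  have h : Complex.exp (Complex.I * (phase (b j) z : ℂ)) *
      (starRingEnd ℂ) (Complex.exp (Complex.I * (phase (b j) z : ℂ))) = 1 := by
    rw [Complex.mul_conj, this]; simp
  simp only [k1, k2, map_mul]
  linear_combination (w₁ z * (starRingEnd ℂ) (w₂ z)) * h

theorem AEPeriodic.comp {F G : Type*} {f : ℝ × ℝ → F} (hf : AEPeriodic b f) (L : F → G) :
    AEPeriodic b fun z => L (f z) := fun v hv => (hf v hv).mono fun _ hz => congrArg L hz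

theorem AEPeriodic.add {f g : ℝ × ℝ → ℝ} (hf : AEPeriodic b f) (hg : AEPeriodic b g) :
    AEPeriodic b fun z => f z + g z := fun v hv => by
  filter_upwards [hf v hv, hg v hv] with z h1 h2
  rw [h1, h2]

theorem AEPeriodic.mul {f g : ℝ × ℝ → ℝ} (hf : AEPeriodic b f) (hg : AEPeriodic b g) :
    AEPeriodic b fun z => f z * g z := fun v hv => by
  filter_upwards [hf v hv, hg v hv] with z h1 h2
  rw [h1, h2]

theorem AEPeriodic.weakDeriv {e : ℝ × ℝ} {f g : ℝ × ℝ → ℝ} (hf : AEPeriodic b f)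
    (h : IsWeakDeriv e f g) : AEPeriodic b g := fun v hv =>
  (h.comp_add_right v).ae_eq (h.congr ((hf v hv).mono fun _ hz => hz.symm)
    (Eventually.of_forall fun _ => rfl))

theorem IsPotential.aePeriodic (ha : IsPotential b a) : AEPeriodic b a := ha.periodic

theorem IsPotential.aePeriodic_curl (ha : IsPotential b a) : AEPeriodic b (curl a) := by
  have h1 := (ha.aePeriodic.comp Prod.snd).weakDeriv ha.h1Loc_snd.isWeakDeriv_dx
  have h2 := (ha.aePeriodic.comp Prod.fst).weakDeriv ha.h1Loc_fst.isWeakDeriv_dy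
  intro v hv
  filter_upwards [h1 v hv, h2 v hv] with z k1 k2
  simp only [curl, k1, k2]

theorem IsPotential.lpLoc_curl (ha : IsPotential b a) : LpLoc 2 (curl a) :=
  LpLoc.sub ha.h1Loc_snd.l2Loc_dx ha.h1Loc_fst.l2Loc_dy

theorem LpLoc.integrableOn_fundamentalDomain {f : ℝ × ℝ → ℝ} (hf : LpLoc 1 f) :
    IntegrableOn f (ZSpan.fundamentalDomain b) :=
  (memLp_one_iff_integrable.1 (hf _ isCompact_closure_fundamentalDomain)).mono_measure
    (Measure.restrict_mono subset_closure le_rfl)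

/-- The curl of a periodic potential has mean zero. -/
theorem IsPotential.setIntegral_curl (ha : IsPotential b a) :
    ∫ z in ZSpan.fundamentalDomain b, curl a z = 0 := by
  refine (ha.aePeriodic.comp Prod.snd).setIntegral_eq_zero (e₁ := (1, 0)) (e₂ := (0, 1))
    (ha.aePeriodic.comp Prod.fst) ha.aePeriodic_curl
    ha.h1Loc_snd.isWeakDeriv_dx.locallyIntegrable ha.h1Loc_fst.isWeakDeriv_dy.locallyIntegrable
    (ha.lpLoc_curl.locallyIntegrable (by norm_num)) fun φ hφ hφs => ?_
  have h1 := ha.h1Loc_snd.isWeakDeriv_dx.integral_eq φ hφ hφs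
  have h2 := ha.h1Loc_fst.isWeakDeriv_dy.integral_eq φ hφ hφs
  simp only [smul_eq_mul] at h1 h2
  rw [h1, h2]
  simp only [curl]
  rw [integral_mul_sub hφ.continuous hφs ha.h1Loc_snd.isWeakDeriv_dx.locallyIntegrable_deriv
    ha.h1Loc_fst.isWeakDeriv_dy.locallyIntegrable_deriv]
  ring

theorem h1Loc_potX (ha : IsPotential b a) : H1Loc (potX a) :=
  (H1Loc.of_contDiff (f := fun z : ℝ × ℝ => -(Real.pi * z.2)) (by fun_prop)).add ha.h1Loc_fst

theorem h1Loc_potY (ha : IsPotential b a) : H1Loc (potY a) :=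
  (H1Loc.of_contDiff (f := fun z : ℝ × ℝ => Real.pi * z.1) (by fun_prop)).add ha.h1Loc_snd

/-- This `-π` and the `π` in the companion lemma for `potY` give `A₀` its curl `2π`. -/
theorem isWeakDeriv_potX (ha : IsPotential b a) :
    IsWeakDeriv (0, 1) (potX a) fun z => -Real.pi + dy (fun w => (a w).1) z := by
  refine ((isWeakDeriv_of_contDiff (f := fun z : ℝ × ℝ => -(Real.pi * z.2)) (by fun_prop)
    (0, 1)).add ha.h1Loc_fst.isWeakDeriv_dy).congr (Eventually.of_forall fun z => rfl)
    (Eventually.of_forall fun z => ?_)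
  have : HasFDerivAt (fun z : ℝ × ℝ => -(Real.pi * z.2))
    (-(Real.pi • ContinuousLinearMap.snd ℝ ℝ ℝ)) z := (hasFDerivAt_snd.const_mul Real.pi).neg
  simp [this.fderiv]

theorem isWeakDeriv_potY (ha : IsPotential b a) :
    IsWeakDeriv (1, 0) (potY a) fun z => Real.pi + dx (fun w => (a w).2) z := by
  refine ((isWeakDeriv_of_contDiff (f := fun z : ℝ × ℝ => Real.pi * z.1) (by fun_prop)
    (1, 0)).add ha.h1Loc_snd.isWeakDeriv_dx).congr (Eventually.of_forall fun z => rfl)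
    (Eventually.of_forall fun z => ?_)
  have : HasFDerivAt (fun z : ℝ × ℝ => Real.pi * z.1)
    (Real.pi • ContinuousLinearMap.fst ℝ ℝ ℝ) z := hasFDerivAt_fst.const_mul Real.pi
  simp [this.fderiv]

theorem IsSection.lpLoc_re (hu : IsSection b u) : LpLoc 4 fun z => (u z).re :=
  (hu.h1Loc.clm_comp Complex.reCLM).lpLoc_four

theorem IsSection.lpLoc_im (hu : IsSection b u) : LpLoc 4 fun z => (u z).im :=
  (hu.h1Loc.clm_comp Complex.imCLM).lpLoc_four

/-- The Sobolev embedding enters here: `|u|² ∈ L²_loc` makes both the potential energy and `curl a ·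
|u|²` locally integrable. -/
theorem IsSection.lpLoc_normSq (hu : IsSection b u) : LpLoc 2 fun z => ‖u z‖ ^ 2 := by
  have : (fun z => ‖u z‖ ^ 2) = fun z => (u z).re * (u z).re + (u z).im * (u z).im := by
    ext z; rw [← Complex.normSq_eq_norm_sq, Complex.normSq_apply]
  rw [this]
  exact LpLoc.add (LpLoc.mul hu.lpLoc_re hu.lpLoc_re) (LpLoc.mul hu.lpLoc_im hu.lpLoc_im)

theorem re_covX (z : ℝ × ℝ) : (covX u a z).re = potX a z * (u z).re - (dx u z).im := by
  simp [covX]; ring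

theorem im_covX (z : ℝ × ℝ) : (covX u a z).im = potX a z * (u z).im + (dx u z).re := by
  simp [covX]; ring

theorem re_covY (z : ℝ × ℝ) : (covY u a z).re = potY a z * (u z).re - (dy u z).im := by
  simp [covY]; ring

theorem im_covY (z : ℝ × ℝ) : (covY u a z).im = potY a z * (u z).im + (dy u z).re := by
  simp [covY]; ring

section Components

variable (hu : IsSection b u) (ha : IsPotential b a)
include hu ha

theorem lpLoc_re_covX : LpLoc 2 fun z => (covX u a z).re := by
  simp only [re_covX]
  exact LpLoc.sub (LpLoc.mul (h1Loc_potX ha).lpLoc_four hu.lpLoc_re)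
    (hu.h1Loc.l2Loc_dx.clm_comp Complex.imCLM)

theorem lpLoc_im_covX : LpLoc 2 fun z => (covX u a z).im := by
  simp only [im_covX]
  exact LpLoc.add (LpLoc.mul (h1Loc_potX ha).lpLoc_four hu.lpLoc_im)
    (hu.h1Loc.l2Loc_dx.clm_comp Complex.reCLM)

theorem lpLoc_re_covY : LpLoc 2 fun z => (covY u a z).re := by
  simp only [re_covY]
  exact LpLoc.sub (LpLoc.mul (h1Loc_potY ha).lpLoc_four hu.lpLoc_re)
    (hu.h1Loc.l2Loc_dy.clm_comp Complex.imCLM)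

theorem lpLoc_im_covY : LpLoc 2 fun z => (covY u a z).im := by
  simp only [im_covY]
  exact LpLoc.add (LpLoc.mul (h1Loc_potY ha).lpLoc_four hu.lpLoc_im)
    (hu.h1Loc.l2Loc_dy.clm_comp Complex.reCLM)

theorem lpLoc_covGradSq : LpLoc 1 (covGradSq u a) := by
  have : covGradSq u a = fun z => ((covX u a z).re * (covX u a z).re +
      (covX u a z).im * (covX u a z).im) + ((covY u a z).re * (covY u a z).re +
      (covY u a z).im * (covY u a z).im) := by
    ext z
    rw [covGradSq_eq, ← Complex.normSq_eq_norm_sq, ← Complex.normSq_eq_norm_sq,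
      Complex.normSq_apply, Complex.normSq_apply]
  rw [this]
  have h : ∀ {f : ℝ × ℝ → ℝ}, LpLoc 2 f → LpLoc 1 fun z => f z * f z :=
    fun hf => LpLoc.mul hf hf
  exact ((h (lpLoc_re_covX hu ha)).add (h (lpLoc_im_covX hu ha))).add
    ((h (lpLoc_re_covY hu ha)).add (h (lpLoc_im_covY hu ha)))

/-- The cross term of the covariant derivatives integrates to minus the energy of the magnetic
field weighted by the density `|u|²`. -/
theorem setIntegral_crossTerm :
    ∫ z in ZSpan.fundamentalDomain b,
      (2 * (covX u a z * (starRingEnd ℂ) (covY u a z)).im +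
        (2 * Real.pi + curl a z) * ‖u z‖ ^ 2) = 0 := by
  have qu := hu.quasiperiodic_phase
  have qx := ae_covX_add hu ha
  have qy := ae_covY_add hu ha
  have le24 : (2 : ℝ≥0∞) ≤ 4 := by norm_num
  have pre := hu.h1Loc.isWeakDeriv_dx.clm_comp Complex.reCLM
  have prey := hu.h1Loc.isWeakDeriv_dy.clm_comp Complex.reCLM
  have pim := hu.h1Loc.isWeakDeriv_dx.clm_comp Complex.imCLM
  have pimy := hu.h1Loc.isWeakDeriv_dy.clm_comp Complex.imCLM
  have l22 : ∀ {f g : ℝ × ℝ → ℝ}, LpLoc 2 f → LpLoc 2 g → LpLoc 1 fun z => f z * g z :=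
    fun hf hg => LpLoc.mul hf hg
  have hcurl : LpLoc 2 fun z => 2 * Real.pi + curl a z :=
    (LpLoc.of_continuous continuous_const).add ha.lpLoc_curl
  have lu := hu.lpLoc_re.mono_exponent le24
  have lv := hu.lpLoc_im.mono_exponent le24
  have hY : ∀ z, (covY u a z * (starRingEnd ℂ) (u z)).re =
      (covY u a z).re * (u z).re + (covY u a z).im * (u z).im := fun z => by
    simp
  have hX : ∀ z, (covX u a z * (starRingEnd ℂ) (u z)).re =
      (covX u a z).re * (u z).re + (covX u a z).im * (u z).im := fun z => by
    simp
  have hXY : ∀ z, (covX u a z * (starRingEnd ℂ) (covY u a z)).im =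
      (covX u a z).im * (covY u a z).re - (covX u a z).re * (covY u a z).im := fun z => by
    simp; ring
  have hsq : ∀ z, ‖u z‖ ^ 2 = (u z).re ^ 2 + (u z).im ^ 2 := fun z => by
    rw [← Complex.normSq_eq_norm_sq, Complex.normSq_apply]; ring
  have pu : AEPeriodic b fun z => ‖u z‖ ^ 2 := by
    have := (aePeriodic_mul_conj qu qu).comp Complex.re
    simpa only [Complex.mul_conj, Complex.ofReal_re, Complex.normSq_eq_norm_sq] using this
  -- The two fields are the components of the supercurrent `Re (D u · conj u)`. The multipliers
  -- cancel in such products, so the current and its curl are periodic.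
  refine AEPeriodic.setIntegral_eq_zero (e₁ := (1, 0)) (e₂ := (0, 1))
    (f₁ := fun z => (covY u a z * (starRingEnd ℂ) (u z)).re)
    (f₂ := fun z => (covX u a z * (starRingEnd ℂ) (u z)).re)
    ((aePeriodic_mul_conj qy qu).comp Complex.re) ((aePeriodic_mul_conj qx qu).comp Complex.re)
    (((aePeriodic_mul_conj qx qy).comp fun w => 2 * w.im).add
      ((ha.aePeriodic_curl.comp fun t => 2 * Real.pi + t).mul pu)) ?_ ?_ ?_ ?_
  · simp only [hY]
    exact ((l22 (lpLoc_re_covY hu ha) lu).add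
      (l22 (lpLoc_im_covY hu ha) lv)).locallyIntegrable le_rfl
  · simp only [hX]
    exact ((l22 (lpLoc_re_covX hu ha) lu).add
      (l22 (lpLoc_im_covX hu ha) lv)).locallyIntegrable le_rfl
  · simp only [hXY]
    exact ((((l22 (lpLoc_im_covX hu ha) (lpLoc_re_covY hu ha)).sub
      (l22 (lpLoc_re_covX hu ha) (lpLoc_im_covY hu ha))).const_mul 2).add
      (l22 hcurl hu.lpLoc_normSq)).locallyIntegrable le_rfl
  · intro φ hφ hφs
    have lY : LpLoc 2 fun z => Real.pi + dx (fun w => (a w).2) z :=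
      (LpLoc.of_continuous continuous_const).add ha.h1Loc_snd.l2Loc_dx
    have lX : LpLoc 2 fun z => -Real.pi + dy (fun w => (a w).1) z :=
      (LpLoc.of_continuous continuous_const).add ha.h1Loc_fst.l2Loc_dy
    have key := integral_curl_current pre prey pim pimy (isWeakDeriv_potX ha)
      (isWeakDeriv_potY ha) hu.lpLoc_re (hu.h1Loc.l2Loc_dx.clm_comp Complex.reCLM)
      (hu.h1Loc.l2Loc_dy.clm_comp Complex.reCLM) hu.lpLoc_im
      (hu.h1Loc.l2Loc_dx.clm_comp Complex.imCLM) (hu.h1Loc.l2Loc_dy.clm_comp Complex.imCLM)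
      (h1Loc_potX ha).lpLoc_four lX (h1Loc_potY ha).lpLoc_four lY hφ hφs
    simp only [Complex.reCLM_apply, Complex.imCLM_apply] at key
    convert key using 3
    · ext z
      rw [hY, re_covY, im_covY]; ring
    · ext z
      rw [hX, re_covX, im_covX]; ring
    · ext z
      rw [hXY, hsq, re_covX, im_covX, re_covY, im_covY, curl]; ring

/-- The Bogomolny inequality. -/
theorem setIntegral_curl_mul_le_setIntegral_covGradSq :
    ∫ z in ZSpan.fundamentalDomain b, (2 * Real.pi + curl a z) * ‖u z‖ ^ 2 ≤
      ∫ z in ZSpan.fundamentalDomain b, covGradSq u a z := by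
  have l22 : ∀ {f g : ℝ × ℝ → ℝ}, LpLoc 2 f → LpLoc 2 g → LpLoc 1 fun z => f z * g z :=
    fun hf hg => LpLoc.mul hf hg
  have hcurl : LpLoc 2 fun z => 2 * Real.pi + curl a z :=
    (LpLoc.of_continuous continuous_const).add ha.lpLoc_curl
  have hXY : ∀ z, (covX u a z * (starRingEnd ℂ) (covY u a z)).im =
      (covX u a z).im * (covY u a z).re - (covX u a z).re * (covY u a z).im := fun z => by
    simp; ring
  have i1 : IntegrableOn (fun z => 2 * (covX u a z * (starRingEnd ℂ) (covY u a z)).im)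
      (ZSpan.fundamentalDomain b) := by
    simp only [hXY]
    exact (((l22 (lpLoc_im_covX hu ha) (lpLoc_re_covY hu ha)).sub
      (l22 (lpLoc_re_covX hu ha) (lpLoc_im_covY hu ha))).const_mul 2).integrableOn_fundamentalDomain
  have i2 : IntegrableOn (fun z => (2 * Real.pi + curl a z) * ‖u z‖ ^ 2)
      (ZSpan.fundamentalDomain b) := (l22 hcurl hu.lpLoc_normSq).integrableOn_fundamentalDomain
  have h := setIntegral_crossTerm hu ha
  rw [integral_add i1 i2] at h
  have h' : ∫ z in ZSpan.fundamentalDomain b, (2 * Real.pi + curl a z) * ‖u z‖ ^ 2 =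
      ∫ z in ZSpan.fundamentalDomain b,
        -(2 * (covX u a z * (starRingEnd ℂ) (covY u a z)).im) := by
    rw [integral_neg]; linarith
  rw [h']
  refine integral_mono i1.neg (lpLoc_covGradSq hu ha).integrableOn_fundamentalDomain fun z => ?_
  -- Pointwise, `-2 Im (D_x u · conj (D_y u)) ≤ 2 |D_x u| |D_y u| ≤ |D_x u|² + |D_y u|²`.
  have h1 : |(covX u a z * (starRingEnd ℂ) (covY u a z)).im| ≤ ‖covX u a z‖ * ‖covY u a z‖ := by
    refine (Complex.abs_im_le_norm _).trans ?_
    rw [norm_mul, RCLike.norm_conj]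
  have h2 := neg_abs_le (covX u a z * (starRingEnd ℂ) (covY u a z)).im
  rw [covGradSq_eq]
  nlinarith [sq_nonneg (‖covX u a z‖ - ‖covY u a z‖)]

end Components

end GinzburgLandau

/-! ### Lower bounds of the energy. -/

namespace GinzburgLandau

open Filter Topology

variable {b : Module.Basis (Fin 2) ℝ (ℝ × ℝ)} {u : ℝ × ℝ → ℂ} {a : ℝ × ℝ → ℝ × ℝ}

theorem integrableOn_one_sub_sq (hu : IsSection b u) :
    IntegrableOn (fun z => 1 / 4 * (1 - ‖u z‖ ^ 2) ^ 2) (ZSpan.fundamentalDomain b) := by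
  have h : LpLoc 2 fun z => 1 - ‖u z‖ ^ 2 :=
    LpLoc.sub (.of_continuous continuous_const) hu.lpLoc_normSq
  have h1 : LpLoc 1 fun z => (1 - ‖u z‖ ^ 2) * (1 - ‖u z‖ ^ 2) := h.mul h
  simp only [sq (1 - ‖u _‖ ^ 2)]
  exact (h1.const_mul _).integrableOn_fundamentalDomain

theorem integrableOn_curl_sq (ha : IsPotential b a) (c : ℝ) :
    IntegrableOn (fun z => c * |curl a z| ^ 2) (ZSpan.fundamentalDomain b) := by
  have h1 : LpLoc 1 fun z => curl a z * curl a z := ha.lpLoc_curl.mul ha.lpLoc_curl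
  simp only [sq_abs, sq (curl a _)]
  exact (h1.const_mul _).integrableOn_fundamentalDomain

theorem integrableOn_covGradSq (hu : IsSection b u) (ha : IsPotential b a) (c : ℝ) :
    IntegrableOn (fun z => c * covGradSq u a z) (ZSpan.fundamentalDomain b) :=
  ((lpLoc_covGradSq hu ha).const_mul c).integrableOn_fundamentalDomain

theorem integrableOn_density (hu : IsSection b u) (ha : IsPotential b a) (k H : ℝ) :
    IntegrableOn (density k H u a) (ZSpan.fundamentalDomain b) :=
  ((integrableOn_covGradSq hu ha _).add (integrableOn_one_sub_sq hu)).add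
    (integrableOn_curl_sq ha _)

theorem covGradSq_nonneg (z : ℝ × ℝ) : 0 ≤ covGradSq u a z := by
  unfold covGradSq; positivity

theorem mu_pos {k H : ℝ} (hk : 0 < k) (hH : 0 < H) : 0 < mu k H := by
  unfold mu; positivity

theorem density_nonneg {k H : ℝ} (hk : 0 < k) (hH : 0 < H) (z : ℝ × ℝ) :
    0 ≤ density k H u a z := by
  have := mu_pos hk hH
  have := covGradSq_nonneg (u := u) (a := a) z
  unfold density; positivity

theorem internalEnergy_eq (hu : IsSection b u) (ha : IsPotential b a) {k H : ℝ} (hk : 0 < k)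
    (hH : 0 < H) : internalEnergy b k H u a =
      ENNReal.ofReal (∫ z in ZSpan.fundamentalDomain b, density k H u a z) :=
  (ofReal_integral_eq_lintegral_ofReal (integrableOn_density hu ha k H)
    (Eventually.of_forall (density_nonneg hk hH))).symm

/-- For `k ≤ 1 / √2` the Bogomolny inequality turns a pointwise lower bound, with the kinetic term
replaced by the magnetic one, into a lower bound of the energy. -/
theorem le_setIntegral_density (hb : volume (ZSpan.fundamentalDomain b) = 1)
    (hu : IsSection b u) (ha : IsPotential b a) {k H : ℝ} (hk : 0 < k) (hH : 0 < H)
    {s : ℝ} (hs : s ^ 2 = 1 / 2) (hs0 : 0 < s) (hks : k ≤ s) {α κ : ℝ}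
    (h : ∀ c w : ℝ, 0 ≤ w → α + κ * c ≤ s * (H / (2 * Real.pi)) * ((2 * Real.pi + c) * w) +
      1 / 4 * (1 - w) ^ 2 + (H / (2 * Real.pi)) ^ 2 / 2 * c ^ 2) :
    α ≤ ∫ z in ZSpan.fundamentalDomain b, density k H u a z := by
  have hpi := Real.pi_pos
  set Ω := ZSpan.fundamentalDomain b
  have hmk : mu k H * k = H / (2 * Real.pi) := by unfold mu; field_simp
  have hmu := mu_pos hk hH
  have iC : IntegrableOn (curl a) Ω :=
    (ha.lpLoc_curl.mono_exponent (p := 1) (by norm_num)).integrableOn_fundamentalDomain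
  have hcurl : LpLoc 2 fun z => 2 * Real.pi + curl a z :=
    (LpLoc.of_continuous continuous_const).add ha.lpLoc_curl
  have iB : IntegrableOn (fun z => s * (H / (2 * Real.pi)) * ((2 * Real.pi + curl a z) *
      ‖u z‖ ^ 2)) Ω :=
    (LpLoc.const_mul _ (hcurl.mul hu.lpLoc_normSq : LpLoc 1 _)).integrableOn_fundamentalDomain
  have iP := integrableOn_one_sub_sq hu
  have iK := integrableOn_curl_sq ha (mu k H ^ 2 * k ^ 2 / 2)
  have iG := integrableOn_covGradSq hu ha (mu k H / 2)
  have : IsFiniteMeasure (volume.restrict Ω) := ⟨by simp [hb, Ω]⟩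
  -- The cell has area `1` and `curl a` has mean zero, so the constant `κ` is free and acts as a
  -- Lagrange multiplier for the mean of the field.
  have e1 : ∫ z in Ω, (α + κ * curl a z) = α := by
    rw [integral_add (integrable_const _) (iC.const_mul κ), integral_const_mul,
      ha.setIntegral_curl]
    simp [Measure.real, Ω, hb]
  have e2 : ∫ z in Ω, (α + κ * curl a z) ≤ ∫ z in Ω,
      (s * (H / (2 * Real.pi)) * ((2 * Real.pi + curl a z) * ‖u z‖ ^ 2) +
        1 / 4 * (1 - ‖u z‖ ^ 2) ^ 2 + mu k H ^ 2 * k ^ 2 / 2 * |curl a z| ^ 2) := by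
    refine integral_mono ((integrable_const _).add (iC.const_mul κ)) ((iB.add iP).add iK)
      fun z => ?_
    have := h (curl a z) (‖u z‖ ^ 2) (by positivity)
    rw [← hmk, mul_pow] at this
    simpa only [sq_abs, ← hmk] using this
  have hX : 0 ≤ ∫ z in Ω, covGradSq u a z := integral_nonneg covGradSq_nonneg
  have hBog := setIntegral_curl_mul_le_setIntegral_covGradSq hu ha
  -- This is the only use of `k ≤ s`: it gives `s μ k ≤ s² μ = μ / 2`, which suffices since the
  -- kinetic integral is non-negative.
  have e3 : ∫ z in Ω, s * (H / (2 * Real.pi)) * ((2 * Real.pi + curl a z) * ‖u z‖ ^ 2) ≤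
      ∫ z in Ω, mu k H / 2 * covGradSq u a z := by
    rw [integral_const_mul, integral_const_mul, ← hmk]
    calc s * (mu k H * k) * ∫ z in Ω, (2 * Real.pi + curl a z) * ‖u z‖ ^ 2
        ≤ s * (mu k H * k) * ∫ z in Ω, covGradSq u a z := by gcongr
      _ ≤ mu k H / 2 * ∫ z in Ω, covGradSq u a z := by
        refine mul_le_mul_of_nonneg_right ?_ hX
        have : s * k ≤ s * s := by gcongr
        nlinarith
  have e4 : ∫ z in Ω, density k H u a z = (∫ z in Ω, mu k H / 2 * covGradSq u a z) +
      (∫ z in Ω, 1 / 4 * (1 - ‖u z‖ ^ 2) ^ 2) +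
      ∫ z in Ω, mu k H ^ 2 * k ^ 2 / 2 * |curl a z| ^ 2 := by
    rw [← integral_add iG iP]
    exact integral_add (iG.add iP) iK
  have e5 : ∫ z in Ω, (s * (H / (2 * Real.pi)) * ((2 * Real.pi + curl a z) * ‖u z‖ ^ 2) +
        1 / 4 * (1 - ‖u z‖ ^ 2) ^ 2 + mu k H ^ 2 * k ^ 2 / 2 * |curl a z| ^ 2) =
      (∫ z in Ω, s * (H / (2 * Real.pi)) * ((2 * Real.pi + curl a z) * ‖u z‖ ^ 2)) +
      (∫ z in Ω, 1 / 4 * (1 - ‖u z‖ ^ 2) ^ 2) +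
      ∫ z in Ω, mu k H ^ 2 * k ^ 2 / 2 * |curl a z| ^ 2 := by
    rw [← integral_add iB iP]
    exact integral_add (iB.add iP) iK
  linarith

/-- With `h = H + m c`, the identity `s² = 1/2` turns the integrand into `(h - s (1 - w))² / 2 + (s
- H) h + H² / 2`. Without the square this is affine in `c`, which determines `α` and `κ`. Adding `(H
- Hext)² / 2` to `α` gives `Hext² / 2 + H (s - Hext)`. -/
theorem pureEnergy_le_totalEnergy (hb : volume (ZSpan.fundamentalDomain b) = 1)
    (hu : IsSection b u) (ha : IsPotential b a) {k H Hext : ℝ} (hk : 0 < k) (hH : 0 < H)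
    {s : ℝ} (hs : s ^ 2 = 1 / 2) (hs0 : 0 < s) (hks : k ≤ s) (hHs : Hext ≤ s) :
    pureEnergy Hext ≤ totalEnergy b k Hext H u a := by
  have hpi := Real.pi_pos
  have key := le_setIntegral_density hb hu ha hk hH hs hs0 hks
    (α := H * s - H ^ 2 / 2) (κ := H / (2 * Real.pi) * s - H * (H / (2 * Real.pi)))
    fun c w _ => by
      have hm : H / (2 * Real.pi) * (2 * Real.pi) = H := by field_simp
      set m := H / (2 * Real.pi)
      have h0 := sq_nonneg (H + m * c - s * (1 - w))
      have h1 : s * m * ((2 * Real.pi + c) * w) = s * (H + m * c) * w := by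
        rw [← hm]; ring
      rw [h1]
      nlinarith
  rw [totalEnergy, pureEnergy, internalEnergy_eq hu ha hk hH,
    ← ENNReal.ofReal_add (integral_nonneg (density_nonneg hk hH)) (by positivity)]
  refine ENNReal.ofReal_le_ofReal ?_
  nlinarith [mul_nonneg hH.le (sub_nonneg.2 hHs)]

/-- With `h = H + m c`, the integrand equals `(h - Hext + s w)² / 2 + s (Hext - s) w + 1/4 - (H -
Hext)² / 2 - (H - Hext) m c`. The first two terms are non-negative for `w ≥ 0`, and `(H - Hext)² /
2` is compensated by the exterior field energy. -/
theorem normalEnergy_le_totalEnergy (hb : volume (ZSpan.fundamentalDomain b) = 1)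
    (hu : IsSection b u) (ha : IsPotential b a) {k H Hext : ℝ} (hk : 0 < k) (hH : 0 < H)
    {s : ℝ} (hs : s ^ 2 = 1 / 2) (hs0 : 0 < s) (hks : k ≤ s) (hHs : s ≤ Hext) :
    normalEnergy ≤ totalEnergy b k Hext H u a := by
  have hpi := Real.pi_pos
  have key := le_setIntegral_density hb hu ha hk hH hs hs0 hks
    (α := 1 / 4 - (H - Hext) ^ 2 / 2) (κ := -(H - Hext) * (H / (2 * Real.pi)))
    fun c w hw => by
      have hm : H / (2 * Real.pi) * (2 * Real.pi) = H := by field_simp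
      set m := H / (2 * Real.pi)
      have h0 := sq_nonneg (H + m * c - Hext + s * w)
      have h1 : s * m * ((2 * Real.pi + c) * w) = s * (H + m * c) * w := by
        rw [← hm]; ring
      have h2 : 0 ≤ s * (Hext - s) * w :=
        mul_nonneg (mul_nonneg hs0.le (sub_nonneg.2 hHs)) hw
      rw [h1]
      nlinarith
  rw [totalEnergy, normalEnergy, internalEnergy_eq hu ha hk hH,
    ← ENNReal.ofReal_add (integral_nonneg (density_nonneg hk hH)) (by positivity)]
  refine ENNReal.ofReal_le_ofReal ?_
  linarith

end GinzburgLandau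

/-! ### Upper bounds by trial states. -/

namespace GinzburgLandau

open Filter Topology

variable {b : Module.Basis (Fin 2) ℝ (ℝ × ℝ)}

theorem IsPotential.zero (b : Module.Basis (Fin 2) ℝ (ℝ × ℝ)) :
    IsPotential b (fun _ => (0 : ℝ × ℝ)) where
  h1Loc_fst := H1Loc.of_contDiff contDiff_const
  h1Loc_snd := H1Loc.of_contDiff contDiff_const
  div_eq_zero := by
    have h1 := (isWeakDeriv_of_contDiff (f := fun _ : ℝ × ℝ => (0 : ℝ)) contDiff_const
      (1, 0)).weakDeriv_ae_eq
    have h2 := (isWeakDeriv_of_contDiff (f := fun _ : ℝ × ℝ => (0 : ℝ)) contDiff_const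
      (0, 1)).weakDeriv_ae_eq
    filter_upwards [h1, h2] with z k1 k2
    simp only [div, dx, dy, Prod.fst_zero, Prod.snd_zero, k1, k2]
    simp
  periodic := by simp
  integral_eq_zero := by simp

theorem curl_zero_ae : curl (fun _ => (0 : ℝ × ℝ)) =ᵐ[volume] 0 := by
  have h1 := (isWeakDeriv_of_contDiff (f := fun _ : ℝ × ℝ => (0 : ℝ)) contDiff_const
    (1, 0)).weakDeriv_ae_eq
  have h2 := (isWeakDeriv_of_contDiff (f := fun _ : ℝ × ℝ => (0 : ℝ)) contDiff_const
    (0, 1)).weakDeriv_ae_eq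
  filter_upwards [h1, h2] with z k1 k2
  simp only [curl, dx, dy, Prod.fst_zero, Prod.snd_zero, k1, k2]
  simp

theorem IsSection.zero (b : Module.Basis (Fin 2) ℝ (ℝ × ℝ)) : IsSection b (fun _ => (0 : ℂ)) where
  h1Loc := H1Loc.of_contDiff contDiff_const
  quasiperiodic := by simp

theorem setIntegral_density_zero {u : ℝ × ℝ → ℂ} (hu : IsSection b u) (k H : ℝ) :
    ∫ z in ZSpan.fundamentalDomain b, density k H u (fun _ => 0) z =
      mu k H / 2 * (∫ z in ZSpan.fundamentalDomain b, covGradSq u (fun _ => 0) z) +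
        ∫ z in ZSpan.fundamentalDomain b, 1 / 4 * (1 - ‖u z‖ ^ 2) ^ 2 := by
  rw [← integral_const_mul, ← integral_add
    (integrableOn_covGradSq hu (IsPotential.zero b) _) (integrableOn_one_sub_sq hu)]
  refine integral_congr_ae (ae_restrict_of_ae ?_)
  filter_upwards [curl_zero_ae] with z hz
  simp [density, hz]

theorem minEnergy_le {k Hext H : ℝ} (hH : 0 < H) {u : ℝ × ℝ → ℂ} {a : ℝ × ℝ → ℝ × ℝ}
    (hu : IsSection b u) (ha : IsPotential b a) :
    minEnergy b k Hext ≤ totalEnergy b k Hext H u a :=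
  iInf_le_of_le H <| iInf_le_of_le hH <| iInf₂_le (u, a) ⟨hu, ha⟩

/-- The trial state is `u = 0`, `a = 0` with `H_int = H_ext`; only the potential term `1/4`
survives. -/
theorem minEnergy_le_normalEnergy (hb : volume (ZSpan.fundamentalDomain b) = 1)
    {k Hext : ℝ} (hk : 0 < k) (hHext : 0 < Hext) : minEnergy b k Hext ≤ normalEnergy := by
  refine (minEnergy_le hHext (IsSection.zero b) (IsPotential.zero b)).trans_eq ?_
  have h0 : covGradSq (fun _ => (0 : ℂ)) (fun _ => (0 : ℝ × ℝ)) =ᵐ[volume] 0 := by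
    have h1 := (isWeakDeriv_of_contDiff (f := fun _ : ℝ × ℝ => (0 : ℂ)) contDiff_const
      (1, 0)).weakDeriv_ae_eq
    have h2 := (isWeakDeriv_of_contDiff (f := fun _ : ℝ × ℝ => (0 : ℂ)) contDiff_const
      (0, 1)).weakDeriv_ae_eq
    filter_upwards [h1, h2] with z k1 k2
    simp only [covGradSq, dx, dy, k1, k2]
    simp
  rw [totalEnergy, normalEnergy, internalEnergy_eq (IsSection.zero b) (IsPotential.zero b) hk hHext,
    setIntegral_density_zero (IsSection.zero b), integral_congr_ae (ae_restrict_of_ae h0)]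
  simp [Measure.real, hb]

/-- Letting `H_int` tend to zero leaves only the potential energy of the section. -/
theorem minEnergy_le_of_isSection {k Hext : ℝ} (hk : 0 < k) {u : ℝ × ℝ → ℂ}
    (hu : IsSection b u) : minEnergy b k Hext ≤
      ENNReal.ofReal ((∫ z in ZSpan.fundamentalDomain b, 1 / 4 * (1 - ‖u z‖ ^ 2) ^ 2) +
        Hext ^ 2 / 2) := by
  set X := ∫ z in ZSpan.fundamentalDomain b, covGradSq u (fun _ => 0) z
  set Q := ∫ z in ZSpan.fundamentalDomain b, 1 / 4 * (1 - ‖u z‖ ^ 2) ^ 2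
  -- With `a = 0` the energy is a continuous function of `H` whose kinetic part is linear in `H`.
  -- The value `H = 0` is not admissible, so it is reached only as a limit from the right.
  have hcont : Continuous fun H : ℝ => ENNReal.ofReal (mu k H / 2 * X + Q + 1 / 2 * (H - Hext) ^ 2) := by
    unfold mu
    exact ENNReal.continuous_ofReal.comp (by fun_prop)
  have hlim : Tendsto (fun H : ℝ => ENNReal.ofReal (mu k H / 2 * X + Q + 1 / 2 * (H - Hext) ^ 2))
      (𝓝[>] 0) (𝓝 (ENNReal.ofReal (Q + Hext ^ 2 / 2))) := by
    refine Tendsto.mono_left ?_ nhdsWithin_le_nhds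
    convert hcont.tendsto 0 using 3
    simp [mu]; ring
  refine ge_of_tendsto hlim ?_
  filter_upwards [self_mem_nhdsWithin] with H hH
  have hH' : 0 < H := hH
  refine (minEnergy_le hH' hu (IsPotential.zero b)).trans_eq ?_
  rw [totalEnergy, internalEnergy_eq hu (IsPotential.zero b) hk hH', ← ENNReal.ofReal_add
    (integral_nonneg (density_nonneg hk hH')) (by positivity), setIntegral_density_zero hu]

/-! ### Sections with modulus close to one. -/

section TestSection

/-- The signed area of the cell spanned by `b`. -/
noncomputable def signedArea (b : Module.Basis (Fin 2) ℝ (ℝ × ℝ)) : ℝ :=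
  (b 0).1 * (b 1).2 - (b 0).2 * (b 1).1

/-- The volume of the cell is the absolute determinant of `b` in the standard basis times the area
of the unit square. -/
theorem abs_signedArea (hb : volume (ZSpan.fundamentalDomain b) = 1) : |signedArea b| = 1 := by
  have h := ZSpan.measure_fundamentalDomain b volume (Module.Basis.finTwoProd ℝ)
  have h1 : ZSpan.fundamentalDomain (Module.Basis.finTwoProd ℝ) =
      Set.Ico (0 : ℝ) 1 ×ˢ Set.Ico (0 : ℝ) 1 := by
    ext z
    simp [ZSpan.mem_fundamentalDomain, Fin.forall_fin_two]
  have h2 : (Module.Basis.finTwoProd ℝ).det b = signedArea b := by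
    rw [Module.Basis.det_apply, Matrix.det_fin_two]
    simp [Module.Basis.toMatrix_apply, signedArea]
    ring
  rw [hb, h1, Measure.volume_eq_prod, Measure.prod_prod, h2] at h
  simp only [Real.volume_Ico, sub_zero, ENNReal.ofReal_one, mul_one] at h
  have := congrArg ENNReal.toReal h
  rw [ENNReal.toReal_ofReal (abs_nonneg _)] at this
  simpa using this.symm

/-- The coordinates with respect to `b`, as smooth functions. -/
theorem contDiff_coord (b : Module.Basis (Fin 2) ℝ (ℝ × ℝ)) (i : Fin 2) :
    ContDiff ℝ ∞ fun z => b.repr z i :=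
  (LinearMap.toContinuousLinearMap (b.coord i)).contDiff

theorem phase_basis_zero (z : ℝ × ℝ) :
    phase (b 0) z = Real.pi * (signedArea b * b.repr z 1) := by
  have h := b.sum_repr z
  rw [Fin.sum_univ_two] at h
  have h1 := congrArg Prod.fst h
  have h2 := congrArg Prod.snd h
  simp only [Prod.fst_add, Prod.snd_add, Prod.smul_fst, Prod.smul_snd, smul_eq_mul] at h1 h2
  rw [phase, signedArea, ← h1, ← h2]
  ring

theorem phase_basis_one (z : ℝ × ℝ) :
    phase (b 1) z = -(Real.pi * (signedArea b * b.repr z 0)) := by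
  have h := b.sum_repr z
  rw [Fin.sum_univ_two] at h
  have h1 := congrArg Prod.fst h
  have h2 := congrArg Prod.snd h
  simp only [Prod.fst_add, Prod.snd_add, Prod.smul_fst, Prod.smul_snd, smul_eq_mul] at h1 h2
  rw [phase, signedArea, ← h1, ← h2]
  ring

/-- A cutoff on the unit interval, tending to `1` inside as `n` grows. -/
noncomputable def intervalCutoff (n : ℕ) : ContDiffBump (1 / 2 : ℝ) where
  -- The bump is `1` on `[1/(n+3), 1 - 1/(n+3)]` and vanishes within `1/(n+4)` of the endpoints. The
  -- shift by `3` keeps the inner radius positive at `n = 0`.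
  rIn := 1 / 2 - 1 / (n + 3)
  rOut := 1 / 2 - 1 / (n + 4)
  rIn_pos := by
    have : (1 : ℝ) / (n + 3) ≤ 1 / 3 := by gcongr; linarith [n.cast_nonneg (α := ℝ)]
    linarith
  rIn_lt_rOut := by
    have : (1 : ℝ) / (n + 4) < 1 / (n + 3) := by gcongr; norm_num
    linarith

theorem intervalCutoff_eq_zero {n : ℕ} {t : ℝ} (ht : t ≤ 1 / (n + 4) ∨ 1 - 1 / (n + 4) ≤ t) :
    intervalCutoff n t = 0 := by
  refine (intervalCutoff n).zero_of_le_dist ?_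
  rw [Real.dist_eq]
  simp only [intervalCutoff]
  rcases ht with h | h
  · rw [abs_sub_comm]; exact le_trans (by linarith) (le_abs_self _)
  · exact le_trans (by linarith) (le_abs_self _)

theorem tendsto_intervalCutoff {t : ℝ} (h0 : 0 < t) (h1 : t < 1) :
    Tendsto (fun n => intervalCutoff n t) atTop (𝓝 1) := by
  have hlim : Tendsto (fun n : ℕ => (1 : ℝ) / (n + 3)) atTop (𝓝 0) := by
    have := (tendsto_one_div_add_atTop_nhds_zero_nat (𝕜 := ℝ)).comp (tendsto_add_atTop_nat 2)
    refine this.congr fun n => ?_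
    simp; ring
  refine tendsto_const_nhds.congr' ?_
  filter_upwards [hlim.eventually (gt_mem_nhds h0), hlim.eventually (gt_mem_nhds (sub_pos.2 h1))]
    with n k1 k2
  refine ((intervalCutoff n).one_of_mem_closedBall ?_).symm
  rw [Metric.mem_closedBall, Real.dist_eq, abs_le]
  simp only [intervalCutoff]
  constructor <;> linarith

/-- The phase of the test section. -/
noncomputable def testPhase (b : Module.Basis (Fin 2) ℝ (ℝ × ℝ)) (m : ℤ) (z : ℝ × ℝ) : ℝ :=
  -- Let `z = s b₀ + t b₁` and let `q` be the signed area. Moving to the next strip, `(t, m) ↦ (t +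
  -- 1, m + 1)`, changes the phase by `-π q s`, exactly the phase of the multiplier of `b₁`. The
  -- shift `s ↦ s + 1` changes it by `π q t - 2π q m`, the phase for `b₀` up to a multiple of `2π`
  -- when `q` is an integer.
  Real.pi * (signedArea b * (b.repr z 0 * b.repr z 1 - 2 * m * b.repr z 0))

/-- A section of modulus close to one away from the lines `t ∈ ℤ`, where `z = s b₀ + t b₁`. -/
noncomputable def testSection (b : Module.Basis (Fin 2) ℝ (ℝ × ℝ)) (n : ℕ) (z : ℝ × ℝ) : ℂ :=
  (intervalCutoff n (Int.fract (b.repr z 1)) : ℂ) *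
    Complex.exp (Complex.I * (testPhase b ⌊b.repr z 1⌋ z : ℂ))

theorem norm_testSection (n : ℕ) (z : ℝ × ℝ) :
    ‖testSection b n z‖ = intervalCutoff n (Int.fract (b.repr z 1)) := by
  rw [testSection, norm_mul, mul_comm Complex.I, Complex.norm_exp_ofReal_mul_I, mul_one,
    Complex.norm_real, Real.norm_of_nonneg (intervalCutoff n).nonneg]

theorem contDiff_testPhase (m : ℤ) : ContDiff ℝ ∞ (testPhase b m) := by
  unfold testPhase
  exact contDiff_const.mul (contDiff_const.mul (((contDiff_coord b 0).mul (contDiff_coord b 1)).sub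
    (contDiff_const.mul (contDiff_coord b 0))))

/-- The floor of `t` jumps only on the lines `t ∈ ℤ`, and the cutoff vanishes in a neighbourhood of
them. Elsewhere the floor is locally constant and the formula is smooth. -/
theorem contDiff_testSection (n : ℕ) : ContDiff ℝ ∞ (testSection b n) := by
  rw [contDiff_iff_contDiffAt]
  intro z₀
  have ht : Continuous fun z => b.repr z 1 := (contDiff_coord b 1).continuous
  set t₀ := b.repr z₀ 1 with ht₀
  rcases (Int.floor_le t₀).eq_or_lt with h | h
  · have hz : testSection b n =ᶠ[𝓝 z₀] fun _ => 0 := by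
      have hpos : (0 : ℝ) < 1 / (n + 4) := by positivity
      have hnear : ∀ᶠ z in 𝓝 z₀, |b.repr z 1 - t₀| < 1 / (n + 4) := by
        have := (ht.tendsto z₀).eventually (Metric.ball_mem_nhds _ hpos)
        filter_upwards [this] with z hz
        simpa [Real.dist_eq] using hz
      filter_upwards [hnear] with z hz
      rw [abs_lt] at hz
      have : intervalCutoff n (Int.fract (b.repr z 1)) = 0 := by
        refine intervalCutoff_eq_zero ?_
        by_cases hlt : b.repr z 1 < t₀
        · right
          have h1 : (⌊b.repr z 1⌋ : ℝ) < (⌊t₀⌋ : ℝ) := by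
            rw [h]; exact (Int.floor_le _).trans_lt hlt
          have h2 : (⌊b.repr z 1⌋ : ℝ) + 1 ≤ (⌊t₀⌋ : ℝ) := by exact_mod_cast h1
          rw [Int.fract]; linarith
        · left
          have h1 : ⌊t₀⌋ ≤ ⌊b.repr z 1⌋ := Int.floor_le_floor (not_lt.1 hlt)
          have h2 : (⌊t₀⌋ : ℝ) ≤ (⌊b.repr z 1⌋ : ℝ) := by exact_mod_cast h1
          rw [Int.fract]; linarith
      simp [testSection, this]
    exact contDiffAt_const.congr_of_eventuallyEq hz
  · have hz : testSection b n =ᶠ[𝓝 z₀] fun z =>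
        (intervalCutoff n (b.repr z 1 - ⌊t₀⌋) : ℂ) *
          Complex.exp (Complex.I * (testPhase b ⌊t₀⌋ z : ℂ)) := by
      have hnear := (ht.tendsto z₀).eventually (Ioo_mem_nhds h (Int.lt_floor_add_one t₀))
      filter_upwards [hnear] with z hz
      have : ⌊b.repr z 1⌋ = ⌊t₀⌋ := Int.floor_eq_iff.2 ⟨hz.1.le, hz.2⟩
      rw [testSection, Int.fract, this]
    refine ContDiffAt.congr_of_eventuallyEq (ContDiff.contDiffAt ?_) hz
    have h1 : ContDiff ℝ ∞ fun z => intervalCutoff n (b.repr z 1 - ⌊t₀⌋) :=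
      (intervalCutoff n).contDiff.comp ((contDiff_coord b 1).sub contDiff_const)
    exact (Complex.ofRealCLM.contDiff.comp h1).mul (Complex.contDiff_exp.comp
      (contDiff_const.mul (Complex.ofRealCLM.contDiff.comp (contDiff_testPhase _))))

theorem isSection_testSection (hb : volume (ZSpan.fundamentalDomain b) = 1) (n : ℕ) :
    IsSection b (testSection b n) where
  h1Loc := H1Loc.of_contDiff (contDiff_testSection n)
  quasiperiodic j := Eventually.of_forall fun z => by
    change testSection b n (z + b j) =
      Complex.exp (Complex.I * (phase (b j) z : ℂ)) * testSection b n z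
    obtain rfl | rfl : j = 0 ∨ j = 1 := by fin_cases j <;> simp
    -- Area `1` makes the signed area `±1`, hence an integer, so the discrepancy `-2π q m`
    -- disappears under the exponential.
    · obtain ⟨q, hq⟩ : ∃ q : ℤ, signedArea b = q := by
        rcases eq_or_eq_neg_of_abs_eq (abs_signedArea hb) with h | h
        · exact ⟨1, by simp [h]⟩
        · exact ⟨-1, by simp [h]⟩
      have e0 : b.repr (z + b 0) 0 = b.repr z 0 + 1 := by simp
      have e1 : b.repr (z + b 0) 1 = b.repr z 1 := by simp
      simp only [testSection, e1]
      rw [mul_left_comm, ← Complex.exp_add]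
      congr 1
      rw [Complex.exp_eq_exp_iff_exists_int]
      refine ⟨-(q * ⌊b.repr z 1⌋), ?_⟩
      rw [phase_basis_zero, testPhase, testPhase, e0, e1, hq]
      push_cast
      ring
    · have e0 : b.repr (z + b 1) 0 = b.repr z 0 := by simp
      have e1 : b.repr (z + b 1) 1 = b.repr z 1 + 1 := by simp
      simp only [testSection, e1, Int.fract_add_one, Int.floor_add_one]
      rw [mul_left_comm, ← Complex.exp_add]
      congr 2
      rw [phase_basis_one, testPhase, testPhase, e0, e1]
      push_cast
      ring

/-- Dominated convergence: inside the cell `0 ≤ t < 1`, and off the null line `t = 0` the cutoff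
tends to `1`. -/
theorem tendsto_setIntegral_testSection (hb : volume (ZSpan.fundamentalDomain b) = 1) :
    Tendsto (fun n => ∫ z in ZSpan.fundamentalDomain b, 1 / 4 * (1 - ‖testSection b n z‖ ^ 2) ^ 2)
      atTop (𝓝 0) := by
  have hfin : IsFiniteMeasure (volume.restrict (ZSpan.fundamentalDomain b)) := ⟨by simp [hb]⟩
  -- The line is the kernel of a nonzero coordinate functional, a proper subspace.
  have hker : volume {z : ℝ × ℝ | b.repr z 1 = 0} = 0 := by
    have h := Measure.addHaar_submodule (volume : Measure (ℝ × ℝ)) (LinearMap.ker (b.coord 1))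
      (fun htop => by
        have : b 1 ∈ LinearMap.ker (b.coord 1) := htop ▸ Submodule.mem_top
        simp at this)
    convert h using 2
    ext z
    simp
  have hlim := tendsto_integral_of_dominated_convergence
    (μ := volume.restrict (ZSpan.fundamentalDomain b))
    (F := fun n z => 1 / 4 * (1 - ‖testSection b n z‖ ^ 2) ^ 2) (f := fun _ => (0 : ℝ))
    (fun _ => (1 / 4 : ℝ)) (fun n => (integrableOn_one_sub_sq (isSection_testSection hb n)).1)
    (integrable_const _) (fun n => Eventually.of_forall fun z => ?_) ?_
  · simpa using hlim
  · have h0 := (intervalCutoff n).nonneg (x := Int.fract (b.repr z 1))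
    have h1 := (intervalCutoff n).le_one (x := Int.fract (b.repr z 1))
    rw [norm_testSection, Real.norm_of_nonneg (by positivity)]
    have : (1 - intervalCutoff n (Int.fract (b.repr z 1)) ^ 2) ^ 2 ≤ 1 := by
      rw [sq_le_one_iff_abs_le_one, abs_le]
      constructor <;> nlinarith
    linarith
  · have hne : ∀ᵐ z ∂(volume.restrict (ZSpan.fundamentalDomain b)), b.repr z 1 ≠ 0 :=
      ae_restrict_of_ae (measure_eq_zero_iff_ae_notMem.1 hker)
    filter_upwards [hne, ae_restrict_mem (ZSpan.fundamentalDomain_measurableSet b)] with z hz hzΩ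
    have hI := (ZSpan.mem_fundamentalDomain b).1 hzΩ 1
    have hfr : Int.fract (b.repr z 1) = b.repr z 1 := Int.fract_eq_self.2 hI
    simp only [norm_testSection, hfr]
    have := tendsto_intervalCutoff (lt_of_le_of_ne hI.1 hz.symm) hI.2
    convert (((this.pow 2).const_sub 1).pow 2).const_mul (1 / 4 : ℝ) using 2
    norm_num

/-- For each fixed `n` the internal field is sent to zero first, and only then `n → ∞`, so no bound
on the kinetic energy uniform in `n` is needed. -/
theorem minEnergy_le_pureEnergy (hb : volume (ZSpan.fundamentalDomain b) = 1)
    {k Hext : ℝ} (hk : 0 < k) : minEnergy b k Hext ≤ pureEnergy Hext := by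
  have h := (tendsto_setIntegral_testSection hb).add_const (Hext ^ 2 / 2)
  rw [zero_add] at h
  exact ge_of_tendsto' ((ENNReal.continuous_ofReal.tendsto _).comp h) fun n =>
    minEnergy_le_of_isSection hk (isSection_testSection hb n)

end TestSection

theorem le_minEnergy {k Hext : ℝ} {E : ℝ≥0∞}
    (h : ∀ H u a, 0 < H → IsSection b u → IsPotential b a → E ≤ totalEnergy b k Hext H u a) :
    E ≤ minEnergy b k Hext :=
  le_iInf fun H => le_iInf fun hH => le_iInf₂ fun p hp => h H p.1 p.2 hH hp.1 hp.2

end GinzburgLandau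

/-! ### Matching the bounds. -/

theorem theorem7 (b : Module.Basis (Fin 2) ℝ (ℝ × ℝ))
    (hb : volume (ZSpan.fundamentalDomain b) = 1)
    (k Hext : ℝ) (hk_pos : 0 < k) (hHext_pos : 0 < Hext) (hk : k ≤ 1 / Real.sqrt 2) :
    (Hext ≤ 1 / Real.sqrt 2 →
      GinzburgLandau.minEnergy b k Hext = GinzburgLandau.pureEnergy Hext ∧
        (k, Hext) ∈ GinzburgLandau.pureSet b) ∧
    (1 / Real.sqrt 2 ≤ Hext →
      GinzburgLandau.minEnergy b k Hext = GinzburgLandau.normalEnergy ∧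
        (k, Hext) ∈ GinzburgLandau.normalSet b) := by
  have hs0 : 0 < 1 / Real.sqrt 2 := by positivity
  have hs : (1 / Real.sqrt 2) ^ 2 = 1 / 2 := by
    rw [div_pow, Real.sq_sqrt (by norm_num)]; norm_num
  refine ⟨fun hH => ?_, fun hH => ?_⟩
  · have h : GinzburgLandau.minEnergy b k Hext = GinzburgLandau.pureEnergy Hext :=
      le_antisymm (GinzburgLandau.minEnergy_le_pureEnergy hb hk_pos)
        (GinzburgLandau.le_minEnergy fun _ _ _ hHint hu ha =>
          GinzburgLandau.pureEnergy_le_totalEnergy hb hu ha hk_pos hHint hs hs0 hk hH)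
    exact ⟨h, hk_pos, hHext_pos, h⟩
  · have h : GinzburgLandau.minEnergy b k Hext = GinzburgLandau.normalEnergy :=
      le_antisymm (GinzburgLandau.minEnergy_le_normalEnergy hb hk_pos hHext_pos)
        (GinzburgLandau.le_minEnergy fun _ _ _ hHint hu ha =>
          GinzburgLandau.normalEnergy_le_totalEnergy hb hu ha hk_pos hHint hs hs0 hk hH)
    exact ⟨h, hk_pos, hHext_pos, h⟩
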